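/- **Proposition.** Let $k,m\ge 1$ and $N=k+m$. Consider the space $M$ of trigonometric polynomials of bidegree $(k,m)$, $$\lambda(p)=e^{ikp}+a_1e^{i(k-1)p}+\dots+a_{k+m}e^{-imp},\qquad a_{k+m}\neq 0,$$ with coordinates $a_1,\dots,a_{N}$ (this is the Hurwitz space $H_{0,k+m}(k,m)$), with the Frobenius structure given by the superpotential $\lambda$ and the primary differential $dp$ on the cylinder $\mathbb C/2\pi\mathbb Z$: $$\langle\partial',\partial''\rangle=-\sum_{d\lambda=0}\operatorname{res}\frac{\partial'(\lambda\,dp)\,\partial''(\lambda\,dp)}{d\lambda},\qquad \langle\partial'\circ\partial'',\partial'''\rangle=-\sum_{d\lambda=0}\operatorname{res}\frac{\partial'(\lambda\,dp)\,\partial''(\lambda\,dp)\,\partial'''(\lambda\,dp)}{dp\,d\lambda},$$ with unity field $e=\partial_{a_k}$ and Euler field $E=\sum_j\frac{j}{k}a_j\partial_{a_j}$; the metric is nondegenerate on $M$ and $e\circ u=u$ for all $u$. Where $\lambda$ has only simple zeros, let $E^{-1}$ be the field with $E^{-1}\circ E=e$ (it exists there), and let $$(u,v)=\langle E^{-1}\circ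 u,v\rangle,\qquad u\star v=E^{-1}\circ u\circ v$$ be the intersection form and the dual multiplication. Then the following hold. 1. Every $\lambda\in M$ can be written as $\lambda(p)=e^{-imp}\prod_{\alpha=1}^{N}\left(e^{ip}-e^{iz^\alpha}\right)$, and every $z\in\mathbb C^N$ gives an element of $M$ in this way. Where the zeros $z^1,\dots,z^{N}$ are pairwise distinct modulo $2\pi$, they are local holomorphic coordinates on $M$, and they are flat coordinates of the intersection form: there is a constant nondegenerate symmetric matrix $G$ with $(\partial_{z^i},\partial_{z^j})=G_{ij}$. 2. In these coordinates the multivalued function $$F^\star=A\sum_{i=1}^{N}(z^i)^3+B\sum_{i=1}^{N}(z^i)^2\sum_{j\ne i}z^j+C\sum_{i<j<l}z^iz^jz^l+\frac12\sum_{i\neq j}\mathrm{Li}_3\!\left(e^{i(z^i-z^j)}\right),$$ $$A=-\frac{i}{12m}\left[(m-2)(m-1)-mk\right],\qquad B=-\frac{i}{4m}(2-m),\qquad C=-\frac{i}{m},$$ is a dual prepotential: for every choice of the branches of $\mathrm{Li}_3$, it is holomorphic wherever the chosen branches are defined, and $$\frac{\partial^3F^\star}{\partial z^a\,\partial z^b\,\partial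 z^c}=\left(\partial_{z^a}\star\partial_{z^b},\partial_{z^c}\right)\qquad\text{for all }a,b,c.$$ Here the branches of $\mathrm{Li}_3$ are the analytic continuations of $\sum_{n\ge1}x^n/n^3$, $|x|<1$; such branches exist near every $x\in\mathbb C\setminus\{0,1\}$. -/

import Mathlib

open Complex Filter Topology

noncomputable section

/-- The residue at `c` of the one-form `f(p) dp`: the value, for all small radii `r`, of
`(2πi)⁻¹ ∮_{|p-c|=r} f(p) dp`. -/
def residueAt (f : ℂ → ℂ) (c : ℂ) : ℂ :=
  limUnder (𝓝[>] (0 : ℝ)) fun r : ℝ => (2 * (Real.pi : ℂ) * I)⁻¹ * ∮ p in C(c, r), f p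

/-- The trigonometric polynomial `λ(p) = e^{ikp} + a₁ e^{i(k-1)p} + … + a_{k+m} e^{-imp}`.
The coefficient `a_j` is `a (j-1)`, as the index starts at zero. -/
def trigPoly (k m : ℕ) (a : Fin (k + m) → ℂ) (p : ℂ) : ℂ :=
  exp (I * (k : ℂ) * p) + ∑ j : Fin (k + m), a j * exp (I * ((k : ℂ) - ((j : ℕ) + 1)) * p)

/-- The space of trigonometric polynomials of bidegree `(k,m)`, in the coordinates
`a₁, …, a_{k+m}`: those with `a_{k+m} ≠ 0`. -/
def trigSpace (k m : ℕ) : Set (Fin (k + m) → ℂ) :=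
  {a | ∀ j : Fin (k + m), (j : ℕ) + 1 = k + m → a j ≠ 0}

/-- The derivative `∂_v λ(p)` of `λ` at `a` along the tangent vector `v`, with `p` kept fixed. -/
def trigVar (k m : ℕ) (a v : Fin (k + m) → ℂ) (p : ℂ) : ℂ :=
  deriv (fun s : ℂ => trigPoly k m (a + s • v) p) 0

/-- The critical points of `λ` on the cylinder `ℂ / 2πℤ`, each represented once. -/
def trigCrit (k m : ℕ) (a : Fin (k + m) → ℂ) : Set ℂ :=
  {p | 0 ≤ p.re ∧ p.re < 2 * Real.pi ∧ deriv (trigPoly k m a) p = 0}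

/-- The metric `⟨u,v⟩ = - ∑ res_{dλ=0} ∂_u(λ dp) ∂_v(λ dp) / dλ`. -/
def trigMetric (k m : ℕ) (a u v : Fin (k + m) → ℂ) : ℂ :=
  - ∑ᶠ p ∈ trigCrit k m a,
      residueAt (fun q => trigVar k m a u q * trigVar k m a v q / deriv (trigPoly k m a) q) p

/-- The tensor `⟨u ∘ v, x⟩ = - ∑ res_{dλ=0} ∂_u(λ dp) ∂_v(λ dp) ∂_x(λ dp) / (dp dλ)`. -/
def trigTensor (k m : ℕ) (a u v x : Fin (k + m) → ℂ) : ℂ :=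
  - ∑ᶠ p ∈ trigCrit k m a,
      residueAt (fun q => trigVar k m a u q * trigVar k m a v q * trigVar k m a x q /
        deriv (trigPoly k m a) q) p

/-- The Gram matrix of the metric in the coordinates `a`. -/
def trigGram (k m : ℕ) (a : Fin (k + m) → ℂ) : Matrix (Fin (k + m)) (Fin (k + m)) ℂ :=
  Matrix.of fun i j => trigMetric k m a (Pi.single i 1) (Pi.single j 1)

/-- The Frobenius multiplication `u ∘ v`, obtained by raising an index of `⟨u ∘ v, ·⟩`. -/
def trigMul (k m : ℕ) (a u v : Fin (k + m) → ℂ) : Fin (k + m) → ℂ :=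
  Matrix.mulVec (trigGram k m a)⁻¹ fun s => trigTensor k m a u v (Pi.single s 1)

/-- The unity vector field `e = ∂/∂a_k`, along which `λ` is shifted by a constant. -/
def trigUnit (k m : ℕ) : Fin (k + m) → ℂ :=
  fun j => if (j : ℕ) + 1 = k then 1 else 0

/-- The Euler vector field `E = ∑ (j/k) a_j ∂/∂a_j`: the generator of the rescalings `λ ↦ c λ`,
combined with the translation of `p` that restores the leading coefficient `1`. -/
def trigEuler (k m : ℕ) (a : Fin (k + m) → ℂ) : Fin (k + m) → ℂ :=
  fun j => (((j : ℕ) : ℂ) + 1) / (k : ℂ) * a j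

/-- The vector field `E⁻¹`, the solution of `E ∘ E⁻¹ = e`. -/
def trigEulerInv (k m : ℕ) (a : Fin (k + m) → ℂ) : Fin (k + m) → ℂ :=
  Matrix.mulVec
    (Matrix.of fun i j => trigMul k m a (trigEuler k m a) (Pi.single j 1) i :
      Matrix (Fin (k + m)) (Fin (k + m)) ℂ)⁻¹
    (trigUnit k m)

/-- The intersection form `(u,v) = ⟨E⁻¹ ∘ u, v⟩`. -/
def trigInter (k m : ℕ) (a u v : Fin (k + m) → ℂ) : ℂ :=
  trigMetric k m a (trigMul k m a (trigEulerInv k m a) u) v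

/-- The dual multiplication `u ⋆ v = E⁻¹ ∘ u ∘ v`. -/
def trigStar (k m : ℕ) (a u v : Fin (k + m) → ℂ) : Fin (k + m) → ℂ :=
  trigMul k m a (trigEulerInv k m a) (trigMul k m a u v)

/-- The coefficients `a_j` as functions of the zeros `z`: `a_j` is the coefficient of
`X^{k+m-j}` in `∏_α (X - e^{i z_α})`. -/
def trigCoeff (k m : ℕ) (z : Fin (k + m) → ℂ) : Fin (k + m) → ℂ :=
  fun j => (∏ α : Fin (k + m), (Polynomial.X - Polynomial.C (exp (I * z α)))).coeff
    (k + m - 1 - (j : ℕ))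

/-- The zeros `z_α` are pairwise distinct modulo `2π`, i.e. `λ` lies off the discriminant. -/
def trigRegular (k m : ℕ) : Set (Fin (k + m) → ℂ) :=
  {z | Function.Injective fun α => exp (I * z α)}

/-- The coordinate vector field `∂/∂z_i`, expressed in the coordinates `a`. -/
def trigField (k m : ℕ) (z : Fin (k + m) → ℂ) (i : Fin (k + m)) : Fin (k + m) → ℂ :=
  fderiv ℂ (trigCoeff k m) z (Pi.single i 1)

/-- The partial derivative `∂F/∂z_i`. -/
def pderivAt {n : ℕ} (i : Fin n) (F : (Fin n → ℂ) → ℂ) (z : Fin n → ℂ) : ℂ :=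
  fderiv ℂ F z (Pi.single i 1)

/-- `IsTrilog f U`: the function element `(f, U)` is a branch of the trilogarithm, i.e. it arises
by a finite chain of direct analytic continuations from `∑_{n ≥ 1} xⁿ / n³` on the unit disc. -/
inductive IsTrilog : (ℂ → ℂ) → Set ℂ → Prop
  | base : IsTrilog (fun x => ∑' n : ℕ, x ^ (n + 1) / ((n : ℂ) + 1) ^ 3) (Metric.ball 0 1)
  | step {f g : ℂ → ℂ} {U V : Set ℂ} {x : ℂ} (hf : IsTrilog f U) (hV : IsOpen V)
      (hc : IsPreconnected V) (hg : AnalyticOnNhd ℂ g V) (hxU : x ∈ U) (hxV : x ∈ V)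
      (h : f =ᶠ[𝓝 x] g) : IsTrilog g V

/-- The function `A ∑ z_i³ + B ∑_i z_i² ∑_{j≠i} z_j + C ∑_{i<j<l} z_i z_j z_l
+ ½ ∑_{i≠j} Li₃(e^{i(z_i - z_j)})`, where `L i j` is the branch of `Li₃` used in the
`(i,j)` summand. -/
def trigPrepotential {n : ℕ} (A B C : ℂ) (L : Fin n → Fin n → ℂ → ℂ) (z : Fin n → ℂ) : ℂ :=
  A * ∑ i, z i ^ 3
    + B * ∑ i, z i ^ 2 * ∑ j ∈ Finset.univ.erase i, z j
    + C * ∑ i, ∑ j ∈ Finset.Ioi i, ∑ l ∈ Finset.Ioi j, z i * z j * z l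
    + 1 / 2 * ∑ i, ∑ j ∈ Finset.univ.erase i, L i j (exp (I * (z i - z j)))

end

/-!
Put `X = e^{ip}`. Then `λ = X^{-m} P(X)` with `P` monic of degree `k + m`, and
`λ'(p) = i X^{-m} Q(X)` with `Q = X P' - m P`. The critical points of `λ` on the cylinder are the
zeros of `Q`, all nonzero, possibly multiple.

*The Frobenius algebra.* In the coordinate `X` the metric and the tensor are sums of residues over
the zeros of `Q` of forms `X^{-s} R(X) dX / Q(X)`. By the residue theorem
(`hasTotalRes_div_rootProd`, proved by partial fractions, which also covers multiple zeros) such a sum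
is a linear functional on `ℂ[X]/(Q)`: the top coefficient of the reduced representative, divided by
`k`. It is nondegenerate. Sending a tangent vector `v` to the restriction of `∂_v λ` to the critical
scheme identifies the tangent space with the algebra `ℂ[X]/(Q)` (`critModel`). Under this
identification `e` is `1` and the Euler field is `λ`, which is invertible exactly when `P` and `Q` are
coprime, so in particular when the zeros of `λ` are simple.

*The dual multiplication.* Let `x_i = e^{iz_i}`. On the critical scheme the field `∂_{z_i}` is
`λ w_i` with `w_i = -i x_i / (X - x_i)`. Two relations determine all products. For `i ≠ j` the partial
fraction expansion of `1 / ((X - x_i) (X - x_j))` expresses `w_i w_j` by `w_i` and `w_j`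
(`trigStar_trigField`), and `∑ w_i = ik` since a simultaneous translation of the zeros is a translation
of `p` up to rescaling (`sum_trigStar_trigField`). The functional takes the same value `i/m` on every
`∂_{z_i}` (`ψ_trigField`), so the intersection form is `δ_{ij} - 1/m`.

*The prepotential.* Every branch of the trilogarithm satisfies `θ³ Li₃ = x / (1 - x)` with
`θ = x d/dx` (`IsTrilog.analytic_and_theta`), so the third derivatives of the prepotential do not
depend on the branches. They satisfy the two relations above, hence agree with the tensor of the dual
multiplication (`eq_cubicTensor`). In particular no computation of the singular diagonal terms is
needed.
-/

/-! ### Residues and their calculus -/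

/-- `HasRes f c v`: on all small circles around `c` the function `f` is integrable, with
`∮ f = 2πi v`. This is the relation behind `residueAt`, and unlike the latter it is linear without
side conditions. -/
def HasRes (f : ℂ → ℂ) (c v : ℂ) : Prop :=
  ∀ᶠ r : ℝ in 𝓝[>] 0, CircleIntegrable f c r ∧ (∮ p in C(c, r), f p) = 2 * Real.pi * I * v

theorem HasRes.residueAt_eq {f : ℂ → ℂ} {c v : ℂ} (h : HasRes f c v) : residueAt f c = v := by
  unfold residueAt
  apply Tendsto.limUnder_eq
  refine tendsto_const_nhds.congr' ?_
  filter_upwards [h] with r hr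
  rw [hr.2, inv_mul_cancel_left₀]
  simp [Real.pi_ne_zero, I_ne_zero]

theorem HasRes.add {f g : ℂ → ℂ} {c v w : ℂ} (hf : HasRes f c v) (hg : HasRes g c w) :
    HasRes (fun q => f q + g q) c (v + w) := by
  filter_upwards [hf, hg] with r hf hg
  refine ⟨hf.1.add hg.1, ?_⟩
  rw [circleIntegral.integral_add hf.1 hg.1, hf.2, hg.2]
  ring

theorem HasRes.const_mul {f : ℂ → ℂ} {c v : ℂ} (hf : HasRes f c v) (b : ℂ) :
    HasRes (fun q => b * f q) c (b * v) := by
  filter_upwards [hf] with r hf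
  refine ⟨by simpa [smul_eq_mul, Pi.smul_def] using hf.1.const_smul (a := b), ?_⟩
  rw [circleIntegral.integral_const_mul, hf.2]
  ring

theorem eventually_forall_mem_sphere {P : ℂ → Prop} {c : ℂ} (h : ∀ᶠ q in 𝓝[≠] c, P q) :
    ∀ᶠ r : ℝ in 𝓝[>] 0, ∀ q ∈ Metric.sphere c r, P q := by
  rw [eventually_nhdsWithin_iff, Metric.eventually_nhds_iff] at h
  obtain ⟨ε, hε, h⟩ := h
  filter_upwards [Ioo_mem_nhdsGT hε] with r hr q hq
  rw [Metric.mem_sphere] at hq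
  refine h (by rw [hq]; exact hr.2) ?_
  rintro rfl
  simp only [dist_self] at hq
  exact hr.1.ne hq

theorem HasRes.congr {f g : ℂ → ℂ} {c v : ℂ} (hf : HasRes f c v) (h : f =ᶠ[𝓝[≠] c] g) :
    HasRes g c v := by
  filter_upwards [hf, eventually_forall_mem_sphere h, self_mem_nhdsWithin] with r hf hr hr0
  have hr0 : (0 : ℝ) < r := hr0
  refine ⟨(circleIntegrable_congr ?_).1 hf.1, ?_⟩
  · rw [abs_of_pos hr0]
    exact hr
  · rw [← hf.2]
    exact (circleIntegral.integral_congr hr0.le hr).symm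

/-- An exact form has no residues. -/
theorem HasRes.of_hasDerivAt {F f : ℂ → ℂ} {c : ℂ}
    (h : ∀ᶠ q in 𝓝[≠] c, HasDerivAt F (f q) q ∧ ContinuousAt f q) : HasRes f c 0 := by
  filter_upwards [eventually_forall_mem_sphere h, self_mem_nhdsWithin] with r hr hr0
  have hr0 : (0 : ℝ) < r := hr0
  refine ⟨ContinuousOn.circleIntegrable hr0.le
    fun q hq => (hr q hq).2.continuousWithinAt, ?_⟩
  rw [circleIntegral.integral_eq_zero_of_hasDerivWithinAt hr0.le
    fun q hq => (hr q hq).1.hasDerivWithinAt, mul_zero]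

theorem HasRes.of_analyticAt {f : ℂ → ℂ} {c : ℂ} (h : AnalyticAt ℂ f c) : HasRes f c 0 := by
  obtain ⟨ε, hε, hb⟩ := Metric.eventually_nhds_iff_ball.1 h.eventually_analyticAt
  have hd : DifferentiableOn ℂ f (Metric.ball c ε) :=
    fun q hq => (hb q hq).differentiableAt.differentiableWithinAt
  obtain ⟨F, hF⟩ := hd.isExactOn_ball
  refine HasRes.of_hasDerivAt (F := F) (eventually_nhdsWithin_of_eventually_nhds ?_)
  filter_upwards [Metric.ball_mem_nhds c hε] with q hq
  exact ⟨hF q hq, (hb q hq).continuousAt⟩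

theorem HasRes.inv_sub (c : ℂ) : HasRes (fun q => (q - c)⁻¹) c 1 := by
  filter_upwards [self_mem_nhdsWithin] with r hr
  have hr0 : (0 : ℝ) < r := hr
  refine ⟨?_, ?_⟩
  · rw [circleIntegrable_sub_inv_iff]
    right
    simp [hr0.ne, abs_of_pos hr0]
  · rw [circleIntegral.integral_sub_center_inv c hr0.ne', mul_one]

theorem hasDerivAt_exp_I_mul (q : ℂ) : HasDerivAt (fun q => exp (I * q)) (I * exp (I * q)) q := by
  have := ((hasDerivAt_id q).const_mul I).cexp
  simpa [mul_comm] using this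

theorem eventually_exp_I_mul_ne (c ξ : ℂ) : ∀ᶠ q in 𝓝[≠] c, exp (I * q) ≠ ξ :=
  (hasDerivAt_exp_I_mul c).eventually_ne (mul_ne_zero I_ne_zero (exp_ne_zero _))

/-- The logarithmic derivative of `e^{iq} - ξ` has residue `1` at its zeros. -/
theorem HasRes.logDeriv_exp (p : ℂ) :
    HasRes (fun q => I * exp (I * q) / (exp (I * q) - exp (I * p))) p 1 := by
  have hexp : AnalyticAt ℂ (fun q => exp (I * q)) p := by fun_prop
  set h : ℂ → ℂ := dslope (fun q => exp (I * q)) p with hh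
  have hha : AnalyticAt ℂ h p := by
    have hd : Differentiable ℂ (fun q => exp (I * q)) := by fun_prop
    have : DifferentiableOn ℂ h Set.univ :=
      (Complex.differentiableOn_dslope Filter.univ_mem).2 hd.differentiableOn
    exact this.analyticAt Filter.univ_mem
  have hp : h p ≠ 0 := by
    rw [hh, dslope_same, (hasDerivAt_exp_I_mul p).deriv]
    exact mul_ne_zero I_ne_zero (exp_ne_zero _)
  have key := (HasRes.inv_sub p).add (HasRes.of_analyticAt (hha.deriv.div hha hp))
  rw [add_zero] at key
  refine key.congr ?_
  filter_upwards [eventually_exp_I_mul_ne p (exp (I * p)), self_mem_nhdsWithin,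
    eventually_nhdsWithin_of_eventually_nhds hha.eventually_analyticAt] with q hq hqp hqa
  have hqp : q ≠ p := hqp
  have hfac : ∀ q, exp (I * q) - exp (I * p) = (q - p) * h q := fun q => by
    simpa [hh] using (sub_smul_dslope (fun q => exp (I * q)) p q).symm
  have hder : I * exp (I * q) = h q + (q - p) * deriv h q := by
    have h1 : HasDerivAt (fun q => (q - p) * h q) (1 * h q + (q - p) * deriv h q) q :=
      ((hasDerivAt_id q).sub_const p).mul hqa.differentiableAt.hasDerivAt
    have h2 : HasDerivAt (fun q => (q - p) * h q) (I * exp (I * q)) q := by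
      have := (hasDerivAt_exp_I_mul q).sub_const (exp (I * p))
      exact this.congr_of_eventuallyEq (Eventually.of_forall fun q => (hfac q).symm)
    rw [h2.unique h1, one_mul]
  have hq0 : q - p ≠ 0 := sub_ne_zero.2 hqp
  have hhq : h q ≠ 0 := by
    intro h0
    apply sub_ne_zero.2 hq
    rw [hfac, h0, mul_zero]
  simp only [Pi.div_apply]
  rw [hfac q, hder]
  field_simp

theorem HasRes.exp_div_sub_pow (p ξ : ℂ) (n : ℕ) :
    HasRes (fun q => I * exp (I * q) / (exp (I * q) - ξ) ^ (n + 2)) p 0 := by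
  refine HasRes.of_hasDerivAt
    (F := fun q => -(1 / ((n : ℂ) + 1)) * ((exp (I * q) - ξ) ^ (n + 1))⁻¹) ?_
  filter_upwards [eventually_exp_I_mul_ne p ξ] with q hq
  have hq0 : exp (I * q) - ξ ≠ 0 := sub_ne_zero.2 hq
  constructor
  · have h1 := ((((hasDerivAt_exp_I_mul q).sub_const ξ).fun_pow (n + 1)).fun_inv
      (pow_ne_zero _ hq0)).const_mul (-(1 / ((n : ℂ) + 1)))
    refine h1.congr_deriv ?_
    have : (n : ℂ) + 1 ≠ 0 := by exact_mod_cast n.succ_ne_zero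
    rw [Nat.add_sub_cancel]
    push_cast
    field_simp
    ring
  · refine ContinuousAt.div (by fun_prop) (by fun_prop) (pow_ne_zero _ hq0)

/-! ### Sums of residues -/

/-- `HasTotalRes T f v`: `f` has a residue at each point of `T`, and these add up to `v`. -/
def HasTotalRes (T : Finset ℂ) (f : ℂ → ℂ) (v : ℂ) : Prop :=
  ∃ w : ℂ → ℂ, (∀ p ∈ T, HasRes f p (w p)) ∧ ∑ p ∈ T, w p = v

theorem HasTotalRes.sum_residueAt {T : Finset ℂ} {f : ℂ → ℂ} {v : ℂ} (h : HasTotalRes T f v) :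
    ∑ p ∈ T, residueAt f p = v := by
  obtain ⟨w, hw, rfl⟩ := h
  exact Finset.sum_congr rfl fun p hp => (hw p hp).residueAt_eq

theorem HasTotalRes.add {T : Finset ℂ} {f g : ℂ → ℂ} {v w : ℂ} (hf : HasTotalRes T f v)
    (hg : HasTotalRes T g w) : HasTotalRes T (fun q => f q + g q) (v + w) := by
  obtain ⟨v', hv, rfl⟩ := hf
  obtain ⟨w', hw, rfl⟩ := hg
  exact ⟨fun p => v' p + w' p, fun p hp => (hv p hp).add (hw p hp), Finset.sum_add_distrib⟩

theorem HasTotalRes.const_mul {T : Finset ℂ} {f : ℂ → ℂ} {v : ℂ} (hf : HasTotalRes T f v) (b : ℂ) :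
    HasTotalRes T (fun q => b * f q) (b * v) := by
  obtain ⟨v', hv, rfl⟩ := hf
  exact ⟨fun p => b * v' p, fun p hp => (hv p hp).const_mul b, (Finset.mul_sum _ _ _).symm⟩

theorem HasTotalRes.congr {T : Finset ℂ} {f g : ℂ → ℂ} {v : ℂ} (hf : HasTotalRes T f v)
    (h : ∀ p ∈ T, f =ᶠ[𝓝[≠] p] g) : HasTotalRes T g v := by
  obtain ⟨v', hv, rfl⟩ := hf
  exact ⟨v', fun p hp => (hv p hp).congr (h p hp), rfl⟩

/-- `∏_{ξ ∈ S} (X - ξ)`. -/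
noncomputable def rootProd (S : Multiset ℂ) : Polynomial ℂ :=
  (S.map fun ξ => Polynomial.X - Polynomial.C ξ).prod

theorem rootProd_cons (ξ : ℂ) (S : Multiset ℂ) :
    rootProd (ξ ::ₘ S) = (Polynomial.X - Polynomial.C ξ) * rootProd S := by
  simp [rootProd]

theorem eventually_eval_exp_ne {D : Polynomial ℂ} (hD : D ≠ 0) (p : ℂ) :
    ∀ᶠ q in 𝓝[≠] p, D.eval (exp (I * q)) ≠ 0 := by
  have : ∀ᶠ q in 𝓝[≠] p, ∀ ξ ∈ D.roots.toFinset, exp (I * q) ≠ ξ :=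
    (Filter.eventually_all_finset _).2 fun ξ _ => eventually_exp_I_mul_ne p ξ
  filter_upwards [this] with q hq h0
  exact hq _ (by rw [Multiset.mem_toFinset, Polynomial.mem_roots hD]; exact h0) rfl

theorem rootProd_monic (S : Multiset ℂ) : (rootProd S).Monic :=
  Polynomial.monic_multiset_prod_of_monic _ _ fun ξ _ => Polynomial.monic_X_sub_C ξ

/-- The form `d(e^{iq}) / ∏_{ξ ∈ S} (e^{iq} - ξ)` has total residue `1` if `S` is a single point, and
`0` if `S` has more points. Two different points of `S` are separated by a partial fraction
expansion, and a power of a single factor gives an exact form. -/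
theorem hasTotalRes_inv_rootProd {T : Finset ℂ} (hT : Set.InjOn (fun p => exp (I * p)) T)
    (n : ℕ) : ∀ S : Multiset ℂ, S.card = n + 1 → (∀ ξ ∈ S, ∃ p ∈ T, exp (I * p) = ξ) →
    HasTotalRes T (fun q => I * exp (I * q) / (rootProd S).eval (exp (I * q)))
      (if n = 0 then 1 else 0) := by
  classical
  induction n with
  | zero =>
    intro S hS hST
    obtain ⟨ξ, rfl⟩ := Multiset.card_eq_one.1 hS
    obtain ⟨p, hp, rfl⟩ := hST ξ (by simp)
    refine ⟨fun q => if q = p then 1 else 0, fun q hq => ?_, by simp [hp]⟩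
    simp only [rootProd, Multiset.map_singleton, Multiset.prod_singleton, Polynomial.eval_sub,
      Polynomial.eval_X, Polynomial.eval_C]
    split_ifs with h
    · subst h
      exact HasRes.logDeriv_exp q
    · refine HasRes.of_analyticAt (AnalyticAt.div (by fun_prop) (by fun_prop) ?_)
      exact sub_ne_zero.2 fun h' => h (hT hq hp h')
  | succ n ih =>
    intro S hS hST
    rw [if_neg n.succ_ne_zero]
    obtain ⟨ξ, S', rfl⟩ : ∃ ξ S', S = ξ ::ₘ S' := by
      have : S ≠ 0 := by rintro rfl; simp at hS
      obtain ⟨ξ, hξ⟩ := Multiset.exists_mem_of_ne_zero this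
      exact ⟨ξ, _, (Multiset.cons_erase hξ).symm⟩
    have hS' : S'.card = n + 1 := by simpa using hS
    by_cases hall : ∀ η ∈ S', η = ξ
    · have hrep : S' = Multiset.replicate (n + 1) ξ := Multiset.eq_replicate.2 ⟨hS', hall⟩
      refine ⟨fun _ => 0, fun p _ => ?_, by simp⟩
      convert HasRes.exp_div_sub_pow p ξ n using 4 with q
      rw [rootProd_cons, hrep]
      simp [rootProd, pow_succ]
      ring
    · -- `1 / ((X - ξ) (X - η)) = (1 / (X - ξ) - 1 / (X - η)) / (ξ - η)`, and the two terms have the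
      -- same total residue.
      push Not at hall
      obtain ⟨η, hη, hne⟩ := hall
      obtain ⟨R, rfl⟩ := Multiset.exists_cons_of_mem hη
      have h1 := ih (η ::ₘ R) hS' fun x hx => hST x (Multiset.mem_cons_of_mem hx)
      have h2 := ih (ξ ::ₘ R) (by simpa using hS') fun x hx => hST x (by
        rw [Multiset.mem_cons] at hx ⊢
        rcases hx with h | h
        · exact Or.inl h
        · exact Or.inr (Multiset.mem_cons_of_mem h))
      have h3 := (h2.add (h1.const_mul (-1))).const_mul ((ξ - η)⁻¹)
      have h0 : (ξ - η)⁻¹ * ((if n = 0 then (1 : ℂ) else 0) + -1 * if n = 0 then (1 : ℂ) else 0)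
        = 0 := by ring
      rw [h0] at h3
      refine h3.congr fun p _ => ?_
      filter_upwards [eventually_eval_exp_ne (rootProd_monic (ξ ::ₘ η ::ₘ R)).ne_zero p] with q hq
      simp only [rootProd_cons, Polynomial.eval_mul, Polynomial.eval_sub, Polynomial.eval_X,
        Polynomial.eval_C, mul_ne_zero_iff] at hq ⊢
      obtain ⟨ha, hb, hc⟩ := hq
      have hne' : ξ - η ≠ 0 := sub_ne_zero.2 (Ne.symm hne)
      field_simp
      ring

/-- The residue theorem for `R(X) dX / ∏_{ξ ∈ S} (X - ξ)` on the sphere, pulled back along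
`X = e^{iq}`: the sum of the residues at the points of `S` is minus the residue at infinity, which is
read off from the leading coefficient. -/
theorem hasTotalRes_div_rootProd {T : Finset ℂ} (hT : Set.InjOn (fun p => exp (I * p)) T)
    (n : ℕ) : ∀ S : Multiset ℂ, S.card = n + 1 → (∀ ξ ∈ S, ∃ p ∈ T, exp (I * p) = ξ) →
    ∀ R : Polynomial ℂ, R.natDegree ≤ n →
    HasTotalRes T (fun q => I * exp (I * q) * R.eval (exp (I * q)) /
      (rootProd S).eval (exp (I * q))) (R.coeff n) := by
  induction n with
  | zero =>
    intro S hS hST R hR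
    rw [Polynomial.eq_C_of_natDegree_le_zero hR]
    have := (hasTotalRes_inv_rootProd hT 0 S hS hST).const_mul (R.coeff 0)
    rw [if_pos rfl, mul_one] at this
    rw [Polynomial.coeff_C_zero]
    refine this.congr fun p _ => Eventually.of_forall fun q => ?_
    simp
    ring
  | succ n ih =>
    intro S hS hST R hR
    obtain ⟨ξ, S', rfl⟩ : ∃ ξ S', S = ξ ::ₘ S' := by
      have : S ≠ 0 := by rintro rfl; simp at hS
      obtain ⟨ξ, hξ⟩ := Multiset.exists_mem_of_ne_zero this
      exact ⟨ξ, _, (Multiset.cons_erase hξ).symm⟩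
    -- `R = (X - ξ) R₁ + R(ξ)`: the constant does not contribute, as there are at least two factors.
    set R₁ := R /ₘ (Polynomial.X - Polynomial.C ξ) with hR₁
    have hdec : (Polynomial.X - Polynomial.C ξ) * R₁ + Polynomial.C (R.eval ξ) = R := by
      rw [hR₁, add_comm, ← Polynomial.modByMonic_X_sub_C_eq_C_eval]
      exact Polynomial.modByMonic_add_div R _
    have hdeg : R₁.natDegree ≤ n := by
      rw [hR₁, Polynomial.natDegree_divByMonic _ (Polynomial.monic_X_sub_C ξ),
        Polynomial.natDegree_X_sub_C]
      omega
    have hcoeff : R.coeff (n + 1) = R₁.coeff n := by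
      rw [← hdec, sub_mul, Polynomial.coeff_add, Polynomial.coeff_sub, Polynomial.coeff_X_mul,
        Polynomial.coeff_C_mul, Polynomial.coeff_C_succ,
        Polynomial.coeff_eq_zero_of_natDegree_lt (by omega : R₁.natDegree < n + 1)]
      simp
    have h1 := ih S' (by simpa using hS) (fun x hx => hST x (Multiset.mem_cons_of_mem hx)) R₁ hdeg
    have h2 := (hasTotalRes_inv_rootProd hT (n + 1) _ hS hST).const_mul (R.eval ξ)
    have h3 := h1.add h2
    rw [if_neg n.succ_ne_zero, mul_zero, add_zero, ← hcoeff] at h3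
    refine h3.congr fun p _ => ?_
    filter_upwards [eventually_eval_exp_ne (rootProd_monic (ξ ::ₘ S')).ne_zero p] with q hq
    have hRq : R.eval (exp (I * q)) = (exp (I * q) - ξ) * R₁.eval (exp (I * q)) + R.eval ξ := by
      conv_lhs => rw [← hdec]
      simp
    simp only [rootProd_cons, Polynomial.eval_mul, Polynomial.eval_sub, Polynomial.eval_X,
        Polynomial.eval_C, mul_ne_zero_iff] at hq ⊢
    obtain ⟨ha, hb⟩ := hq
    rw [hRq]
    field_simp

/-! ### The polynomials attached to `λ` -/

open Polynomial in
/-- The polynomial `V(X) = ∑_j v_j X^{n-1-j}` of degree less than `n`: the numerator of the variation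
`∂_v λ = X^{-m} V(X)`, where `X = e^{ip}`. -/
noncomputable def varPoly (n : ℕ) : (Fin n → ℂ) →ₗ[ℂ] ℂ[X] where
  toFun v := ∑ j : Fin n, C (v j) * X ^ (n - 1 - (j : ℕ))
  map_add' u v := by simp [add_mul, Finset.sum_add_distrib]
  map_smul' c v := by simp [Finset.mul_sum, mul_assoc, Polynomial.smul_eq_C_mul]

open Polynomial in
/-- The numerator `P(X) = X^{k+m} + a₁ X^{k+m-1} + … + a_{k+m}` of `λ = X^{-m} P(X)`, where
`X = e^{ip}`. -/
noncomputable def numPoly (k m : ℕ) (a : Fin (k + m) → ℂ) : ℂ[X] :=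
  X ^ (k + m) + varPoly (k + m) a

open Polynomial in
/-- The numerator `Q = X P' - m P` of the derivative `λ'(p) = i X^{-m} Q(X)`. -/
noncomputable def critPoly (k m : ℕ) (a : Fin (k + m) → ℂ) : ℂ[X] :=
  X * derivative (numPoly k m a) - C (m : ℂ) * numPoly k m a

section Polynomials
open Polynomial

theorem varPoly_apply (n : ℕ) (v : Fin n → ℂ) :
    varPoly n v = ∑ j : Fin n, C (v j) * X ^ (n - 1 - (j : ℕ)) := rfl

theorem varPoly_coeff (n : ℕ) (v : Fin n → ℂ) (j : Fin n) :
    (varPoly n v).coeff (n - 1 - (j : ℕ)) = v j := by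
  rw [varPoly_apply, finsetSum_coeff, Finset.sum_eq_single j]
  · simp
  · intro i _ hij
    rw [coeff_C_mul_X_pow, if_neg]
    intro h
    apply hij
    ext
    omega
  · simp

theorem varPoly_degree_lt (n : ℕ) (v : Fin n → ℂ) : (varPoly n v).degree < n := by
  rw [varPoly_apply, ← mem_degreeLT]
  refine Submodule.sum_mem _ fun j _ => ?_
  rw [mem_degreeLT]
  refine (degree_C_mul_X_pow_le _ _).trans_lt ?_
  exact_mod_cast (by omega : n - 1 - (j : ℕ) < n)

theorem varPoly_of_coeff {n : ℕ} {R : ℂ[X]} (hR : R.degree < n) :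
    varPoly n (fun j => R.coeff (n - 1 - (j : ℕ))) = R := by
  ext d
  by_cases hd : d < n
  · have := varPoly_coeff n (fun j => R.coeff (n - 1 - (j : ℕ))) ⟨n - 1 - d, by omega⟩
    simp only at this
    rwa [show n - 1 - (n - 1 - d) = d by omega] at this
  · have hd : (n : WithBot ℕ) ≤ d := by exact_mod_cast not_lt.1 hd
    rw [coeff_eq_zero_of_degree_lt ((varPoly_degree_lt n _).trans_le hd),
      coeff_eq_zero_of_degree_lt (hR.trans_le hd)]

theorem varPoly_injective (n : ℕ) : Function.Injective (varPoly n) := fun u v h => by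
  ext j
  rw [← varPoly_coeff n u j, h, varPoly_coeff]

theorem numPoly_monic (k m : ℕ) (a : Fin (k + m) → ℂ) : (numPoly k m a).Monic :=
  monic_X_pow_add (varPoly_degree_lt _ _)

theorem numPoly_natDegree (k m : ℕ) (a : Fin (k + m) → ℂ) : (numPoly k m a).natDegree = k + m := by
  rw [natDegree_eq_of_degree_eq_some (n := k + m)]
  rw [numPoly, degree_add_eq_left_of_degree_lt, degree_X_pow]
  rw [degree_X_pow]
  exact varPoly_degree_lt _ _

theorem numPoly_coeff_zero {k m : ℕ} (hk : 1 ≤ k) {a : Fin (k + m) → ℂ} (ha : a ∈ trigSpace k m) :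
    (numPoly k m a).coeff 0 ≠ 0 := by
  have h1 := varPoly_coeff (k + m) a ⟨k + m - 1, by omega⟩
  simp only [Nat.sub_self] at h1
  rw [numPoly, coeff_add, h1, coeff_X_pow, if_neg (by omega), zero_add]
  exact ha _ (by simp; omega)

theorem critPoly_coeff (k m : ℕ) (a : Fin (k + m) → ℂ) (d : ℕ) :
    (critPoly k m a).coeff d = ((d : ℂ) - m) * (numPoly k m a).coeff d := by
  rw [critPoly, coeff_sub, coeff_C_mul]
  cases d with
  | zero => simp
  | succ d =>
    rw [coeff_X_mul, coeff_derivative]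
    push_cast
    ring

theorem critPoly_coeff_top (k m : ℕ) (a : Fin (k + m) → ℂ) :
    (critPoly k m a).coeff (k + m) = k := by
  have := (numPoly_monic k m a).coeff_natDegree
  rw [numPoly_natDegree] at this
  rw [critPoly_coeff, this]
  push_cast
  ring

theorem critPoly_natDegree {k m : ℕ} (hk : 1 ≤ k) (a : Fin (k + m) → ℂ) :
    (critPoly k m a).natDegree = k + m := by
  refine le_antisymm ?_ (le_natDegree_of_ne_zero ?_)
  · rw [natDegree_le_iff_coeff_eq_zero]
    intro d hd
    rw [critPoly_coeff, coeff_eq_zero_of_natDegree_lt (by rwa [numPoly_natDegree]), mul_zero]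
  · rw [critPoly_coeff_top]
    exact_mod_cast (by omega : k ≠ 0)

theorem critPoly_ne_zero {k m : ℕ} (hk : 1 ≤ k) (a : Fin (k + m) → ℂ) : critPoly k m a ≠ 0 := by
  intro h
  have := critPoly_natDegree hk a
  rw [h, natDegree_zero] at this
  omega

theorem critPoly_coeff_zero (k m : ℕ) (a : Fin (k + m) → ℂ) :
    (critPoly k m a).coeff 0 = -(m : ℂ) * (numPoly k m a).coeff 0 := by
  rw [critPoly_coeff]
  push_cast
  ring

theorem critPoly_eq_rootProd {k m : ℕ} (hk : 1 ≤ k) (a : Fin (k + m) → ℂ) :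
    critPoly k m a = C (k : ℂ) * rootProd (critPoly k m a).roots := by
  have h := C_leadingCoeff_mul_prod_multiset_X_sub_C (p := critPoly k m a)
    (IsAlgClosed.card_roots_eq_natDegree)
  rw [leadingCoeff, critPoly_natDegree hk, critPoly_coeff_top] at h
  exact h.symm

theorem card_critPoly_roots {k m : ℕ} (hk : 1 ≤ k) (a : Fin (k + m) → ℂ) :
    (critPoly k m a).roots.card = k + m := by
  rw [IsAlgClosed.card_roots_eq_natDegree, critPoly_natDegree hk]

theorem rootProd_natDegree (S : Multiset ℂ) : (rootProd S).natDegree = S.card :=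
  natDegree_multiset_prod_X_sub_C_eq_card S

/-- The Euler field is represented by `λ`, up to a multiple of the derivative of `λ`. -/
theorem varPoly_trigEuler {k m : ℕ} (hk : 1 ≤ k) (a : Fin (k + m) → ℂ) :
    varPoly (k + m) (trigEuler k m a) =
      numPoly k m a - C ((k : ℂ)⁻¹) * critPoly k m a := by
  have hk0 : (k : ℂ) ≠ 0 := by exact_mod_cast (by omega : k ≠ 0)
  have hc : ∀ d, (numPoly k m a - C ((k : ℂ)⁻¹) * critPoly k m a).coeff d =
      ((k : ℂ) + m - d) / k * (numPoly k m a).coeff d := fun d => by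
    rw [coeff_sub, coeff_C_mul, critPoly_coeff]
    field_simp
    ring
  have hdeg : (numPoly k m a - C ((k : ℂ)⁻¹) * critPoly k m a).degree < (k + m : ℕ) := by
    rw [degree_lt_iff_coeff_zero]
    intro d hd
    rw [hc]
    rcases hd.eq_or_lt with rfl | hd
    · push_cast
      ring
    · rw [coeff_eq_zero_of_natDegree_lt (by rwa [numPoly_natDegree]), mul_zero]
  rw [← varPoly_of_coeff hdeg]
  congr 1
  ext j
  have hj : k + m - 1 - (j : ℕ) ≠ k + m := by omega
  rw [hc, numPoly, coeff_add, varPoly_coeff, coeff_X_pow, if_neg hj, zero_add, trigEuler,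
    Nat.cast_sub (by omega), Nat.cast_sub (by omega)]
  push_cast
  ring

theorem varPoly_trigUnit {k m : ℕ} (hk : 1 ≤ k) :
    varPoly (k + m) (trigUnit k m) = X ^ m := by
  have hdeg : (X ^ m : ℂ[X]).degree < (k + m : ℕ) := by
    rw [degree_X_pow]
    exact_mod_cast (by omega : m < k + m)
  rw [← varPoly_of_coeff hdeg]
  congr 1
  ext j
  rw [coeff_X_pow, trigUnit]
  congr 1
  simp only [eq_iff_iff]
  omega

end Polynomials

/-! ### The superpotential in the coordinate `X = e^{ip}` -/

theorem exp_sub_natCast (n : ℕ) (m : ℕ) (p : ℂ) :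
    exp (I * ((n : ℂ) - m) * p) = exp (-(I * m * p)) * exp (I * p) ^ n := by
  rw [← exp_nat_mul, ← exp_add]
  congr 1
  ring

theorem exp_mul_varPoly (k m : ℕ) (v : Fin (k + m) → ℂ) (p : ℂ) :
    ∑ j : Fin (k + m), v j * exp (I * ((k : ℂ) - ((j : ℕ) + 1)) * p) =
      exp (-(I * m * p)) * (varPoly (k + m) v).eval (exp (I * p)) := by
  rw [varPoly_apply, Polynomial.eval_finsetSum, Finset.mul_sum]
  refine Finset.sum_congr rfl fun j _ => ?_
  have h : (k : ℂ) - ((j : ℕ) + 1) = ((k + m - 1 - (j : ℕ) : ℕ) : ℂ) - m := by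
    have hj := j.2
    rw [Nat.cast_sub (by omega), Nat.cast_sub (by omega)]
    push_cast
    ring
  rw [h, exp_sub_natCast]
  simp
  ring

theorem trigPoly_eq (k m : ℕ) (a : Fin (k + m) → ℂ) (p : ℂ) :
    trigPoly k m a p = exp (-(I * m * p)) * (numPoly k m a).eval (exp (I * p)) := by
  have h : (k : ℂ) = ((k + m : ℕ) : ℂ) - m := by push_cast; ring
  rw [trigPoly, exp_mul_varPoly, numPoly, Polynomial.eval_add, mul_add, h, exp_sub_natCast]
  simp

theorem trigVar_eq (k m : ℕ) (a v : Fin (k + m) → ℂ) (p : ℂ) :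
    trigVar k m a v p = exp (-(I * m * p)) * (varPoly (k + m) v).eval (exp (I * p)) := by
  have h : (fun s : ℂ => trigPoly k m (a + s • v) p) = fun s =>
      trigPoly k m a p + s * (exp (-(I * m * p)) * (varPoly (k + m) v).eval (exp (I * p))) := by
    ext s
    rw [trigPoly_eq, trigPoly_eq, numPoly, numPoly, map_add, map_smul]
    simp
    ring
  rw [trigVar, h]
  simp

theorem deriv_trigPoly (k m : ℕ) (a : Fin (k + m) → ℂ) (p : ℂ) :
    deriv (trigPoly k m a) p =
      I * exp (-(I * m * p)) * (critPoly k m a).eval (exp (I * p)) := by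
  have h1 : HasDerivAt (fun p => exp (-(I * m * p))) (exp (-(I * m * p)) * (-(I * m))) p := by
    simpa using ((hasDerivAt_id p).const_mul (I * (m : ℂ))).fun_neg.cexp
  have h2 : HasDerivAt (fun p => (numPoly k m a).eval (exp (I * p)))
      ((Polynomial.derivative (numPoly k m a)).eval (exp (I * p)) * (I * exp (I * p))) p :=
    HasDerivAt.comp (h₂ := fun x => (numPoly k m a).eval x) p
      ((numPoly k m a).hasDerivAt (exp (I * p))) (hasDerivAt_exp_I_mul p)
  have h3 : trigPoly k m a = fun p => exp (-(I * m * p)) * (numPoly k m a).eval (exp (I * p)) :=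
    funext (trigPoly_eq k m a)
  rw [h3, (h1.fun_mul h2).deriv]
  simp [critPoly]
  ring

/-! ### The critical points on the cylinder -/

theorem injOn_exp_I_mul :
    Set.InjOn (fun p : ℂ => exp (I * p)) {p | 0 ≤ p.re ∧ p.re < 2 * Real.pi} := by
  intro p hp q hq h
  obtain ⟨n, hn⟩ := exp_eq_exp_iff_exists_int.1 h
  have hpq : p = q + n * (2 * Real.pi) := by
    have : I * p = I * (q + n * (2 * Real.pi)) := by rw [hn]; ring
    exact mul_left_cancel₀ I_ne_zero this
  have hre : p.re = q.re + n * (2 * Real.pi) := by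
    rw [hpq]
    simp
  obtain ⟨hp1, hp2⟩ := hp
  obtain ⟨hq1, hq2⟩ := hq
  have hpi := Real.pi_pos
  have h1 : (n : ℝ) < 1 := by
    by_contra hcon
    nlinarith
  have h2 : (-1 : ℝ) < n := by
    by_contra hcon
    nlinarith
  have hn0 : n = 0 := by
    have h1' : n < 1 := by exact_mod_cast h1
    have h2' : -1 < n := by exact_mod_cast h2
    omega
  rw [hpq, hn0]
  simp

theorem exists_exp_I_mul_eq {ξ : ℂ} (hξ : ξ ≠ 0) :
    ∃ p : ℂ, (0 ≤ p.re ∧ p.re < 2 * Real.pi) ∧ exp (I * p) = ξ := by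
  have hpi := Real.pi_pos
  have hre : (-I * log ξ).re = arg ξ := by simp [log_im]
  have hexp : exp (I * (-I * log ξ)) = ξ := by
    rw [show I * (-I * log ξ) = log ξ by rw [← mul_assoc]; simp, exp_log hξ]
  by_cases h : 0 ≤ arg ξ
  · refine ⟨-I * log ξ, ?_, hexp⟩
    rw [hre]
    exact ⟨h, by linarith [arg_le_pi ξ]⟩
  · refine ⟨-I * log ξ + 2 * Real.pi, ?_, ?_⟩
    · rw [add_re, hre]
      have : (2 * (Real.pi : ℂ)).re = 2 * Real.pi := by simp
      rw [this]
      constructor <;> linarith [neg_pi_lt_arg ξ]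
    · rw [mul_add, exp_add, hexp, show I * (2 * (Real.pi : ℂ)) = 2 * Real.pi * I by ring,
        exp_two_pi_mul_I, mul_one]

theorem mem_trigCrit (k m : ℕ) (a : Fin (k + m) → ℂ) (p : ℂ) :
    p ∈ trigCrit k m a ↔
      (0 ≤ p.re ∧ p.re < 2 * Real.pi) ∧ (critPoly k m a).eval (exp (I * p)) = 0 := by
  simp [trigCrit, deriv_trigPoly, and_assoc]

theorem trigCrit_finite {k m : ℕ} (hk : 1 ≤ k) (a : Fin (k + m) → ℂ) : (trigCrit k m a).Finite := by
  refine Set.Finite.of_finite_image (f := fun p : ℂ => exp (I * p)) ?_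
    (injOn_exp_I_mul.mono fun p hp => ((mem_trigCrit k m a p).1 hp).1)
  refine (critPoly k m a).roots.toFinset.finite_toSet.subset ?_
  rintro _ ⟨p, hp, rfl⟩
  simp only [Finset.mem_coe, Multiset.mem_toFinset]
  exact (Polynomial.mem_roots (critPoly_ne_zero hk a)).2 ((mem_trigCrit k m a p).1 hp).2

/-! ### The algebra of functions on the critical scheme -/

/-- The algebra `ℂ[X]/(Q)` of functions on the critical scheme of `λ`. The modulus is the monic
multiple of `Q`. -/
abbrev CritAlg (k m : ℕ) (a : Fin (k + m) → ℂ) : Type :=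
  AdjoinRoot (rootProd (critPoly k m a).roots)

section CritAlg
open Polynomial

/-- The total residue of `R(X) dX / Q` over the zeros of `Q`, as a functional of the class of `R`:
by the residue theorem it is the top coefficient of the reduced representative, divided by the leading
coefficient `k` of `Q`. -/
noncomputable def critTrace (k m : ℕ) (a : Fin (k + m) → ℂ) : CritAlg k m a →ₗ[ℂ] ℂ :=
  (k : ℂ)⁻¹ • (lcoeff ℂ (k + m - 1)).comp (AdjoinRoot.modByMonicHom (rootProd_monic _))

theorem critTrace_mk (k m : ℕ) (a : Fin (k + m) → ℂ) (R : ℂ[X]) :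
    critTrace k m a (AdjoinRoot.mk _ R) =
      (k : ℂ)⁻¹ * (R %ₘ rootProd (critPoly k m a).roots).coeff (k + m - 1) := by
  simp [critTrace]

theorem modulus_degree {k m : ℕ} (hk : 1 ≤ k) (a : Fin (k + m) → ℂ) :
    (rootProd (critPoly k m a).roots).degree = (k + m : ℕ) := by
  rw [degree_eq_natDegree (rootProd_monic _).ne_zero, rootProd_natDegree, card_critPoly_roots hk]

theorem critTrace_mk_of_degree_lt {k m : ℕ} (hk : 1 ≤ k) (a : Fin (k + m) → ℂ) {R : ℂ[X]}
    (hR : R.degree < (k + m : ℕ)) :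
    critTrace k m a (AdjoinRoot.mk _ R) = (k : ℂ)⁻¹ * R.coeff (k + m - 1) := by
  rw [critTrace_mk, (modByMonic_eq_self_iff (rootProd_monic _)).2]
  rwa [modulus_degree hk]

theorem exists_rep {k m : ℕ} (hk : 1 ≤ k) (a : Fin (k + m) → ℂ) (f : CritAlg k m a) :
    ∃ R : ℂ[X], R.degree < (k + m : ℕ) ∧ AdjoinRoot.mk _ R = f := by
  obtain ⟨R, rfl⟩ := AdjoinRoot.mk_surjective f
  refine ⟨R %ₘ rootProd (critPoly k m a).roots, ?_, ?_⟩
  · rw [← modulus_degree hk a]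
    exact degree_modByMonic_lt _ (rootProd_monic _)
  · exact AdjoinRoot.mk_leftInverse (rootProd_monic _) (AdjoinRoot.mk _ R)

theorem critTrace_nondegenerate {k m : ℕ} (hk : 1 ≤ k) (a : Fin (k + m) → ℂ) (f : CritAlg k m a)
    (hf : ∀ g, critTrace k m a (f * g) = 0) : f = 0 := by
  obtain ⟨R, hR, rfl⟩ := exists_rep hk a f
  by_contra h0
  have hR0 : R ≠ 0 := fun h => h0 (by rw [h, map_zero])
  have hd : R.natDegree < k + m := (natDegree_lt_iff_degree_lt hR0).2 hR
  -- This power of `X` moves the leading term of `R` to the degree seen by the functional.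
  have h1 := hf (AdjoinRoot.mk _ (X ^ (k + m - 1 - R.natDegree)))
  rw [← map_mul, critTrace_mk_of_degree_lt hk] at h1
  · rw [show k + m - 1 = R.natDegree + (k + m - 1 - R.natDegree) by omega,
      show R.natDegree + (k + m - 1 - R.natDegree) - R.natDegree = k + m - 1 - R.natDegree by omega,
      coeff_mul_X_pow] at h1
    have hk0 : (k : ℂ) ≠ 0 := by exact_mod_cast (by omega : k ≠ 0)
    exact hR0 (leadingCoeff_eq_zero.1 (by simpa [hk0] using h1))
  · rw [degree_mul, degree_X_pow, degree_eq_natDegree hR0]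
    exact_mod_cast (by omega : R.natDegree + (k + m - 1 - R.natDegree) < k + m)

theorem mk_critPoly {k m : ℕ} (hk : 1 ≤ k) (a : Fin (k + m) → ℂ) :
    AdjoinRoot.mk (rootProd (critPoly k m a).roots) (critPoly k m a) = 0 := by
  rw [AdjoinRoot.mk_eq_zero, ← dvd_C_mul (a := (k : ℂ)⁻¹)]
  · refine ⟨1, ?_⟩
    have hk0 : (k : ℂ) ≠ 0 := by exact_mod_cast (by omega : k ≠ 0)
    conv_lhs => rw [critPoly_eq_rootProd hk a]
    rw [← mul_assoc, ← C_mul, inv_mul_cancel₀ hk0, C_1, one_mul, mul_one]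
  · exact inv_ne_zero (by exact_mod_cast (by omega : k ≠ 0))

/-- `X` is invertible on the critical scheme, since `Q(0) = -m P(0) ≠ 0`. -/
theorem isUnit_root {k m : ℕ} (hk : 1 ≤ k) (hm : 1 ≤ m) {a : Fin (k + m) → ℂ}
    (ha : a ∈ trigSpace k m) : IsUnit (AdjoinRoot.root (rootProd (critPoly k m a).roots)) := by
  have h0 : (critPoly k m a).coeff 0 ≠ 0 := by
    rw [critPoly_coeff_zero]
    refine mul_ne_zero (neg_ne_zero.2 ?_) (numPoly_coeff_zero hk ha)
    exact_mod_cast (by omega : m ≠ 0)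
  have h1 : X * divX (critPoly k m a) + C ((critPoly k m a).coeff 0) = critPoly k m a :=
    X_mul_divX_add _
  have h2 := congrArg (AdjoinRoot.mk (rootProd (critPoly k m a).roots)) h1
  rw [mk_critPoly hk, map_add, map_mul, AdjoinRoot.mk_X] at h2
  refine IsUnit.of_mul_eq_one (AdjoinRoot.mk _ (divX (critPoly k m a)) *
    AdjoinRoot.mk _ (C (-((critPoly k m a).coeff 0)⁻¹))) ?_
  rw [← mul_assoc, eq_neg_of_add_eq_zero_left h2, ← map_neg, ← map_mul, ← C_neg, ← C_mul,
    neg_mul_neg, mul_inv_cancel₀ h0, C_1, map_one]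

/-- The inverse of the class of `X` in `ℂ[X]/(Q)`. -/
noncomputable def critInv (k m : ℕ) (a : Fin (k + m) → ℂ) : CritAlg k m a :=
  Ring.inverse (AdjoinRoot.root _)

theorem root_mul_critInv {k m : ℕ} (hk : 1 ≤ k) (hm : 1 ≤ m) {a : Fin (k + m) → ℂ}
    (ha : a ∈ trigSpace k m) : AdjoinRoot.root _ * critInv k m a = 1 :=
  Ring.mul_inverse_cancel _ (isUnit_root hk hm ha)

/-- The total residue of `e^{-isq} W(e^{iq})` over the critical points. The factor `e^{-isq}` may be
replaced by a polynomial that is inverse to `X^s` modulo `Q`, because the difference is holomorphic. -/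
theorem hasTotalRes_critTrace {k m : ℕ} (hk : 1 ≤ k) (hm : 1 ≤ m) {a : Fin (k + m) → ℂ}
    (ha : a ∈ trigSpace k m) (s : ℕ) (W : ℂ[X]) :
    HasTotalRes (trigCrit_finite hk a).toFinset
      (fun q => I * exp (I * q) * ((exp (I * q))⁻¹ ^ s * W.eval (exp (I * q))) /
        (critPoly k m a).eval (exp (I * q)))
      (critTrace k m a (critInv k m a ^ s * AdjoinRoot.mk _ W)) := by
  set D := rootProd (critPoly k m a).roots with hD
  have hk0 : (k : ℂ) ≠ 0 := by exact_mod_cast (by omega : k ≠ 0)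
  have hcrit : critPoly k m a = C (k : ℂ) * D := critPoly_eq_rootProd hk a
  obtain ⟨R, hR, hRW⟩ := exists_rep hk a (critInv k m a ^ s * AdjoinRoot.mk _ W)
  obtain ⟨K, hK⟩ : D ∣ X ^ s * R - W := by
    rw [← AdjoinRoot.mk_eq_mk, map_mul, hRW, map_pow, AdjoinRoot.mk_X, ← mul_assoc, ← mul_pow,
      root_mul_critInv hk hm ha, one_pow, one_mul]
  have hinj : Set.InjOn (fun p : ℂ => exp (I * p)) (trigCrit_finite hk a).toFinset := by
    rw [Set.Finite.coe_toFinset]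
    exact injOn_exp_I_mul.mono fun p hp => ((mem_trigCrit k m a p).1 hp).1
  have hsurj : ∀ ξ ∈ (critPoly k m a).roots, ∃ p ∈ (trigCrit_finite hk a).toFinset,
      exp (I * p) = ξ := fun ξ hξ => by
    have h0 : (critPoly k m a).eval ξ = 0 := (mem_roots'.1 hξ).2
    have hξ0 : ξ ≠ 0 := by
      rintro rfl
      rw [← coeff_zero_eq_eval_zero, critPoly_coeff_zero, mul_eq_zero, neg_eq_zero] at h0
      rcases h0 with h0 | h0
      · exact absurd h0 (by exact_mod_cast (by omega : m ≠ 0))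
      · exact numPoly_coeff_zero hk ha h0
    obtain ⟨p, hp, rfl⟩ := exists_exp_I_mul_eq hξ0
    exact ⟨p, by rw [Set.Finite.mem_toFinset, mem_trigCrit]; exact ⟨hp, h0⟩, rfl⟩
  have hRn : R.natDegree ≤ k + m - 1 := by
    by_cases hR0 : R = 0
    · simp [hR0]
    · have := (natDegree_lt_iff_degree_lt hR0).2 hR
      omega
  have h1 := (hasTotalRes_div_rootProd hinj (k + m - 1) _
    (by rw [card_critPoly_roots hk]; omega) hsurj R hRn).const_mul (k : ℂ)⁻¹
  have h2 : HasTotalRes (trigCrit_finite hk a).toFinset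
      (fun q => -(k : ℂ)⁻¹ * (I * exp (I * q)) *
        ((exp (I * q))⁻¹ ^ s * K.eval (exp (I * q)))) 0 := by
    refine ⟨fun _ => 0, fun p _ => HasRes.of_analyticAt ?_, by simp⟩
    have hexp : AnalyticAt ℂ (fun q : ℂ => exp (I * q)) p := by fun_prop
    have hKa : AnalyticAt ℂ (fun q : ℂ => K.eval (exp (I * q))) p :=
      (AnalyticAt.aeval_polynomial hexp K)
    have hinv : AnalyticAt ℂ (fun q : ℂ => (exp (I * q))⁻¹) p := hexp.fun_inv (exp_ne_zero _)
    exact (analyticAt_const.mul (analyticAt_const.mul hexp)).mul ((hinv.fun_pow s).mul hKa)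
  rw [← hD] at h1
  rw [← hRW, critTrace_mk_of_degree_lt hk a hR, ← add_zero ((k : ℂ)⁻¹ * _)]
  refine (h1.add h2).congr fun p _ => ?_
  filter_upwards [eventually_eval_exp_ne (rootProd_monic (critPoly k m a).roots).ne_zero p]
    with q hq
  rw [← hD] at hq
  have hKe := congrArg (Polynomial.eval (exp (I * q))) hK
  rw [eval_sub, eval_mul, eval_mul, eval_pow, eval_X] at hKe
  have hE : exp (I * q) ≠ 0 := exp_ne_zero _
  have hW : W.eval (exp (I * q)) =
      exp (I * q) ^ s * R.eval (exp (I * q)) - D.eval (exp (I * q)) * K.eval (exp (I * q)) := by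
    rw [← hKe]
    ring
  have hQ : (critPoly k m a).eval (exp (I * q)) = k * D.eval (exp (I * q)) := by
    conv_lhs => rw [hcrit]
    rw [eval_mul, eval_C]
  rw [hQ, hW, inv_pow]
  field_simp
  ring

end CritAlg

/-! ### The tangent space as a Frobenius algebra -/

theorem inv_toMatrix'_mulVec {n : ℕ} (f : (Fin n → ℂ) ≃ₗ[ℂ] (Fin n → ℂ)) (w : Fin n → ℂ) :
    Matrix.mulVec (LinearMap.toMatrix' (f : (Fin n → ℂ) →ₗ[ℂ] (Fin n → ℂ)))⁻¹ w = f.symm w := by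
  have h : LinearMap.toMatrix' (f : (Fin n → ℂ) →ₗ[ℂ] (Fin n → ℂ)) *
      LinearMap.toMatrix' (f.symm : (Fin n → ℂ) →ₗ[ℂ] (Fin n → ℂ)) = 1 := by
    rw [← LinearMap.toMatrix'_comp]
    simp
  rw [Matrix.inv_eq_right_inv h, LinearMap.toMatrix'_mulVec]
  rfl

/-- An identification `ι` of the tangent space at `a` with a commutative algebra `A`, under which the
metric and the tensor become `ψ(uv)` and `ψ(uvx)` for a nondegenerate functional `ψ` on `A`. -/
structure TrigModel (k m : ℕ) (a : Fin (k + m) → ℂ) (A : Type*) [CommRing A] [Algebra ℂ A] where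
  ι : (Fin (k + m) → ℂ) ≃ₗ[ℂ] A
  ψ : A →ₗ[ℂ] ℂ
  nondeg : ∀ f, (∀ g, ψ (f * g) = 0) → f = 0
  metric : ∀ u v, trigMetric k m a u v = ψ (ι u * ι v)
  tensor : ∀ u v x, trigTensor k m a u v x = ψ (ι u * ι v * ι x)

namespace TrigModel
variable {k m : ℕ} {a : Fin (k + m) → ℂ} {A : Type*} [CommRing A] [Algebra ℂ A]

/-- The map `v ↦ ⟨v, ·⟩` given by the Gram matrix. -/
noncomputable def lower (M : TrigModel k m a A) : (Fin (k + m) → ℂ) ≃ₗ[ℂ] (Fin (k + m) → ℂ) :=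
  LinearEquiv.ofInjectiveEndo
    (LinearMap.pi fun i => M.ψ ∘ₗ LinearMap.mulLeft ℂ (M.ι (Pi.single i 1)) ∘ₗ
      M.ι.toLinearMap) <| by
    rw [injective_iff_map_eq_zero]
    intro v hv
    have h1 : ∀ u, M.ψ (M.ι u * M.ι v) = 0 := fun u => by
      let L : (Fin (k + m) → ℂ) →ₗ[ℂ] ℂ :=
        M.ψ ∘ₗ LinearMap.mulRight ℂ (M.ι v) ∘ₗ M.ι.toLinearMap
      have hL : L = 0 := by
        refine LinearMap.pi_ext' fun i => LinearMap.ext_ring ?_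
        simpa [L] using congrFun hv i
      exact LinearMap.congr_fun hL u
    have h2 : M.ι v = 0 := M.nondeg _ fun g => by
      have := h1 (M.ι.symm g)
      rwa [M.ι.apply_symm_apply, mul_comm] at this
    exact M.ι.map_eq_zero_iff.1 h2

theorem lower_apply (M : TrigModel k m a A) (v : Fin (k + m) → ℂ) (i : Fin (k + m)) :
    M.lower v i = M.ψ (M.ι (Pi.single i 1) * M.ι v) := rfl

theorem trigGram_eq (M : TrigModel k m a A) :
    trigGram k m a = LinearMap.toMatrix' (M.lower : (Fin (k + m) → ℂ) →ₗ[ℂ] (Fin (k + m) → ℂ)) := by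
  ext i j
  rw [LinearMap.toMatrix'_apply]
  simp [trigGram, M.metric, lower_apply]

theorem isUnit_det_trigGram (M : TrigModel k m a A) : IsUnit (trigGram k m a).det := by
  rw [M.trigGram_eq, ← Matrix.isUnit_iff_isUnit_det]
  exact LinearMap.isUnit_toMatrix'_iff.2 ((Module.End.isUnit_iff _).2 M.lower.bijective)

theorem trigMul_eq (M : TrigModel k m a A) (u v : Fin (k + m) → ℂ) :
    trigMul k m a u v = M.ι.symm (M.ι u * M.ι v) := by
  rw [trigMul, M.trigGram_eq, inv_toMatrix'_mulVec, LinearEquiv.symm_apply_eq]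
  ext i
  rw [lower_apply, M.tensor, M.ι.apply_symm_apply, mul_comm]

theorem ι_trigMul (M : TrigModel k m a A) (u v : Fin (k + m) → ℂ) :
    M.ι (trigMul k m a u v) = M.ι u * M.ι v := by
  rw [M.trigMul_eq, M.ι.apply_symm_apply]

/-- Where the Euler field is invertible, `E⁻¹` is its inverse. -/
theorem ι_trigEulerInv_mul (M : TrigModel k m a A) (h1 : M.ι (trigUnit k m) = 1)
    (hE : IsUnit (M.ι (trigEuler k m a))) :
    M.ι (trigEulerInv k m a) * M.ι (trigEuler k m a) = 1 := by
  obtain ⟨e, he⟩ := hE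
  let f : (Fin (k + m) → ℂ) ≃ₗ[ℂ] (Fin (k + m) → ℂ) :=
    M.ι.trans ((LinearEquiv.ofBijective (LinearMap.mulLeft ℂ (e : A))
      ⟨e.isUnit.mul_right_injective, fun y => ⟨(↑e⁻¹ : A) * y, by simp⟩⟩).trans M.ι.symm)
  have hf : ∀ v, f v = M.ι.symm (e * M.ι v) := fun v => rfl
  have hmat : (Matrix.of fun i j => trigMul k m a (trigEuler k m a) (Pi.single j 1) i :
      Matrix (Fin (k + m)) (Fin (k + m)) ℂ) =
      LinearMap.toMatrix' (f : (Fin (k + m) → ℂ) →ₗ[ℂ] (Fin (k + m) → ℂ)) := by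
    ext i j
    rw [LinearMap.toMatrix'_apply]
    simp [M.trigMul_eq, hf, he]
  have h2 : f (trigEulerInv k m a) = trigUnit k m := by
    rw [trigEulerInv, hmat, inv_toMatrix'_mulVec, LinearEquiv.apply_symm_apply]
  rw [hf, he, LinearEquiv.symm_apply_eq, h1] at h2
  rw [mul_comm, h2]

end TrigModel

section CritModel
open Polynomial

/-- The identification of a tangent vector `v` with the restriction of `∂_v λ = X^{-m} V(X)` to the
critical scheme. -/
noncomputable def critIota {k m : ℕ} (hk : 1 ≤ k) (hm : 1 ≤ m) {a : Fin (k + m) → ℂ}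
    (ha : a ∈ trigSpace k m) : (Fin (k + m) → ℂ) ≃ₗ[ℂ] CritAlg k m a :=
  LinearEquiv.ofBijective
    (LinearMap.mulLeft ℂ (critInv k m a ^ m) ∘ₗ (AdjoinRoot.mkₐ _).toLinearMap ∘ₗ
      varPoly (k + m)) <| by
    have hu : IsUnit (critInv k m a ^ m) :=
      (IsUnit.of_mul_eq_one _ ((mul_comm _ _).trans (root_mul_critInv hk hm ha))).pow m
    constructor
    · rw [injective_iff_map_eq_zero]
      intro v hv
      have hv : critInv k m a ^ m * AdjoinRoot.mk _ (varPoly (k + m) v) = 0 := hv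
      rw [hu.mul_right_eq_zero, AdjoinRoot.mk_eq_zero] at hv
      have h0 := eq_zero_of_dvd_of_degree_lt hv
        (by rw [modulus_degree hk]; exact varPoly_degree_lt _ v)
      exact varPoly_injective _ (h0.trans (map_zero _).symm)
    · intro f
      obtain ⟨g, rfl⟩ := hu.dvd (a := f)
      obtain ⟨R, hR, rfl⟩ := exists_rep hk a g
      exact ⟨_, congrArg (fun R => critInv k m a ^ m * AdjoinRoot.mk _ R) (varPoly_of_coeff hR)⟩

theorem critIota_apply {k m : ℕ} (hk : 1 ≤ k) (hm : 1 ≤ m) {a : Fin (k + m) → ℂ}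
    (ha : a ∈ trigSpace k m) (v : Fin (k + m) → ℂ) :
    critIota hk hm ha v = critInv k m a ^ m * AdjoinRoot.mk _ (varPoly (k + m) v) := rfl

theorem exp_neg_I_mul (m : ℕ) (q : ℂ) : exp (-(I * m * q)) = (exp (I * q))⁻¹ ^ m := by
  rw [← exp_neg, ← exp_nat_mul]
  congr 1
  ring

theorem trigMetric_eq {k m : ℕ} (hk : 1 ≤ k) (hm : 1 ≤ m) {a : Fin (k + m) → ℂ}
    (ha : a ∈ trigSpace k m) (u v : Fin (k + m) → ℂ) :
    trigMetric k m a u v = critTrace k m a (critInv k m a ^ (m + 1) *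
      AdjoinRoot.mk _ (varPoly (k + m) u * varPoly (k + m) v)) := by
  have h1 := (hasTotalRes_critTrace hk hm ha (m + 1)
    (varPoly (k + m) u * varPoly (k + m) v)).const_mul (-1)
  rw [trigMetric, finsum_mem_eq_finite_toFinset_sum _ (trigCrit_finite hk a), neg_eq_iff_eq_neg,
    ← neg_one_mul]
  refine (h1.congr fun p _ => Eventually.of_forall fun q => ?_).sum_residueAt
  simp only [trigVar_eq, deriv_trigPoly, eval_mul, exp_neg_I_mul]
  have hE : exp (I * q) ≠ 0 := exp_ne_zero _
  have hI : (I : ℂ)⁻¹ = -I := inv_I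
  rw [div_eq_mul_inv, div_eq_mul_inv, mul_inv, mul_inv, hI]
  simp only [inv_pow, inv_inv]
  field_simp
  ring

theorem trigTensor_eq {k m : ℕ} (hk : 1 ≤ k) (hm : 1 ≤ m) {a : Fin (k + m) → ℂ}
    (ha : a ∈ trigSpace k m) (u v x : Fin (k + m) → ℂ) :
    trigTensor k m a u v x = critTrace k m a (critInv k m a ^ (2 * m + 1) *
      AdjoinRoot.mk _ (varPoly (k + m) u * varPoly (k + m) v * varPoly (k + m) x)) := by
  have h1 := (hasTotalRes_critTrace hk hm ha (2 * m + 1)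
    (varPoly (k + m) u * varPoly (k + m) v * varPoly (k + m) x)).const_mul (-1)
  rw [trigTensor, finsum_mem_eq_finite_toFinset_sum _ (trigCrit_finite hk a), neg_eq_iff_eq_neg,
    ← neg_one_mul]
  refine (h1.congr fun p _ => Eventually.of_forall fun q => ?_).sum_residueAt
  simp only [trigVar_eq, deriv_trigPoly, eval_mul, exp_neg_I_mul]
  have hE : exp (I * q) ≠ 0 := exp_ne_zero _
  have hI : (I : ℂ)⁻¹ = -I := inv_I
  rw [div_eq_mul_inv, div_eq_mul_inv, mul_inv, mul_inv, hI]
  simp only [inv_pow, inv_inv]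
  field_simp
  ring

/-- The tangent space at `a` is the algebra of functions on the critical scheme of `λ`, with the
functional `f ↦ ∑ res f X^{m-1} dX / Q`. -/
noncomputable def critModel {k m : ℕ} (hk : 1 ≤ k) (hm : 1 ≤ m) {a : Fin (k + m) → ℂ}
    (ha : a ∈ trigSpace k m) : TrigModel k m a (CritAlg k m a) where
  ι := critIota hk hm ha
  ψ := critTrace k m a ∘ₗ LinearMap.mulLeft ℂ (critInv k m a * AdjoinRoot.root _ ^ m)
  nondeg f hf := by
    have hxy := root_mul_critInv hk hm ha
    refine critTrace_nondegenerate hk a f fun g => ?_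
    have h := hf (AdjoinRoot.root _ * critInv k m a ^ m * g)
    rw [← h]
    simp only [LinearMap.comp_apply, LinearMap.mulLeft_apply]
    congr 1
    calc f * g = (AdjoinRoot.root _ * critInv k m a) ^ (m + 1) * (f * g) := by
          rw [hxy, one_pow, one_mul]
      _ = _ := by ring
  metric u v := by
    have hxy := root_mul_critInv hk hm ha
    rw [trigMetric_eq hk hm ha, map_mul (AdjoinRoot.mk _)]
    simp only [LinearMap.comp_apply, LinearMap.mulLeft_apply, critIota_apply]
    congr 1
    calc _ = (AdjoinRoot.root _ * critInv k m a) ^ m * (critInv k m a ^ (m + 1) *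
          (AdjoinRoot.mk _ (varPoly (k + m) u) * AdjoinRoot.mk _ (varPoly (k + m) v))) := by
          rw [hxy, one_pow, one_mul]
      _ = _ := by ring
  tensor u v x := by
    have hxy := root_mul_critInv hk hm ha
    rw [trigTensor_eq hk hm ha, map_mul (AdjoinRoot.mk _), map_mul (AdjoinRoot.mk _)]
    simp only [LinearMap.comp_apply, LinearMap.mulLeft_apply, critIota_apply]
    congr 1
    calc _ = (AdjoinRoot.root _ * critInv k m a) ^ m * (critInv k m a ^ (2 * m + 1) *
          (AdjoinRoot.mk _ (varPoly (k + m) u) * AdjoinRoot.mk _ (varPoly (k + m) v) *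
            AdjoinRoot.mk _ (varPoly (k + m) x))) := by
          rw [hxy, one_pow, one_mul]
      _ = _ := by ring

section
variable {k m : ℕ} (hk : 1 ≤ k) (hm : 1 ≤ m) {a : Fin (k + m) → ℂ} (ha : a ∈ trigSpace k m)

theorem critModel_ι (v : Fin (k + m) → ℂ) :
    (critModel hk hm ha).ι v = critInv k m a ^ m * AdjoinRoot.mk _ (varPoly (k + m) v) := rfl

theorem critModel_ψ (f : CritAlg k m a) :
    (critModel hk hm ha).ψ f = critTrace k m a (critInv k m a * AdjoinRoot.root _ ^ m * f) := rfl

theorem critModel_ι_unit : (critModel hk hm ha).ι (trigUnit k m) = 1 := by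
  rw [critModel_ι, varPoly_trigUnit hk, map_pow, AdjoinRoot.mk_X, ← mul_pow, mul_comm,
    root_mul_critInv hk hm ha, one_pow]

theorem critModel_ι_euler : (critModel hk hm ha).ι (trigEuler k m a) =
    critInv k m a ^ m * AdjoinRoot.mk _ (numPoly k m a) := by
  rw [critModel_ι, varPoly_trigEuler hk, map_sub, map_mul, mk_critPoly hk, mul_zero, sub_zero]

/-- `λ` is invertible on its critical scheme if its zeros are simple. -/
theorem isUnit_critModel_ι_euler (hsep : (numPoly k m a).Separable) :
    IsUnit ((critModel hk hm ha).ι (trigEuler k m a)) := by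
  have hX : IsCoprime (numPoly k m a) X := by
    rw [isCoprime_comm, irreducible_X.coprime_iff_not_dvd, X_dvd_iff]
    exact numPoly_coeff_zero hk ha
  have hQ : IsCoprime (numPoly k m a) (critPoly k m a) := by
    have h1 : IsCoprime (numPoly k m a) (X * derivative (numPoly k m a)) := hX.mul_right hsep
    have h2 := h1.add_mul_left_right (-C (m : ℂ))
    rwa [show X * derivative (numPoly k m a) + numPoly k m a * -C (m : ℂ) = critPoly k m a by
      rw [critPoly]; ring] at h2
  obtain ⟨r, s, hrs⟩ := hQ
  have h3 := congrArg (AdjoinRoot.mk (rootProd (critPoly k m a).roots)) hrs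
  rw [map_add, map_mul, map_mul, mk_critPoly hk, mul_zero, add_zero, map_one] at h3
  rw [critModel_ι_euler]
  refine IsUnit.mul (IsUnit.pow _ ?_) (IsUnit.of_mul_eq_one _ ((mul_comm _ _).trans h3))
  exact IsUnit.of_mul_eq_one _ ((mul_comm _ _).trans (root_mul_critInv hk hm ha))

end

end CritModel

/-! ### The zeros of `λ` as coordinates -/

section Zeros
open Polynomial

theorem numPoly_trigCoeff (k m : ℕ) (z : Fin (k + m) → ℂ) :
    numPoly k m (trigCoeff k m z) = ∏ α, (X - C (exp (I * z α))) := by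
  set Z : ℂ[X] := ∏ α, (X - C (exp (I * z α))) with hZ
  have hmon : Z.Monic := monic_prod_of_monic _ _ fun α _ => monic_X_sub_C _
  have hdeg : Z.degree = (k + m : ℕ) := by
    rw [degree_eq_natDegree hmon.ne_zero, hZ, natDegree_finsetProd_X_sub_C_eq_card]
    simp
  have hlt : (Z - X ^ (k + m)).degree < ((k + m : ℕ) : WithBot ℕ) := by
    rw [← hdeg]
    refine degree_sub_lt_left (by rw [hdeg, degree_X_pow]) hmon.ne_zero ?_
    rw [hmon.leadingCoeff, leadingCoeff_X_pow]
  have h := varPoly_of_coeff hlt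
  rw [numPoly, ← add_sub_cancel (X ^ (k + m)) Z, ← h]
  congr 2
  ext j
  have hj := j.2
  rw [coeff_sub, coeff_X_pow, if_neg (by omega), sub_zero]
  rfl

theorem trigCoeff_mem_trigSpace {k m : ℕ} (z : Fin (k + m) → ℂ) :
    trigCoeff k m z ∈ trigSpace k m := by
  intro j hj
  rw [trigCoeff, show k + m - 1 - (j : ℕ) = 0 by omega, coeff_zero_eq_eval_zero, eval_prod,
    Finset.prod_ne_zero_iff]
  intro α _
  simp

theorem trigPoly_trigCoeff (k m : ℕ) (z : Fin (k + m) → ℂ) (p : ℂ) :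
    trigPoly k m (trigCoeff k m z) p =
      exp (-(I * (m : ℂ) * p)) * ∏ α : Fin (k + m), (exp (I * p) - exp (I * z α)) := by
  rw [trigPoly_eq, numPoly_trigCoeff, eval_prod]
  simp

theorem exists_trigCoeff_eq {k m : ℕ} (hk : 1 ≤ k) {a : Fin (k + m) → ℂ} (ha : a ∈ trigSpace k m) :
    ∃ z, trigCoeff k m z = a := by
  have hcard : (numPoly k m a).roots.card = k + m := by
    rw [IsAlgClosed.card_roots_eq_natDegree, numPoly_natDegree]
  have hprod := prod_multiset_X_sub_C_of_monic_of_roots_card_eq (numPoly_monic k m a)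
    (by rw [hcard, numPoly_natDegree])
  set l := (numPoly k m a).roots.toList with hl
  have hlen : l.length = k + m := by rw [hl, Multiset.length_toList, hcard]
  have hz0 : ∀ i : Fin (k + m), l.get (i.cast hlen.symm) ≠ 0 := fun i h0 => by
    have hmem : l.get (i.cast hlen.symm) ∈ (numPoly k m a).roots := by
      rw [← Multiset.mem_toList]
      exact List.get_mem _ _
    have := (mem_roots'.1 hmem).2
    rw [h0, IsRoot.def, ← coeff_zero_eq_eval_zero] at this
    exact numPoly_coeff_zero hk ha this
  refine ⟨fun i => -I * log (l.get (i.cast hlen.symm)), ?_⟩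
  have h1 : numPoly k m (trigCoeff k m fun i => -I * log (l.get (i.cast hlen.symm))) =
      numPoly k m a := by
    rw [numPoly_trigCoeff, ← hprod]
    have h2 : ∀ i : Fin (k + m), exp (I * (-I * log (l.get (i.cast hlen.symm)))) =
        l.get (i.cast hlen.symm) := fun i => by
      rw [← mul_assoc, mul_neg, I_mul_I, neg_neg, one_mul, exp_log (hz0 i)]
    simp only [h2]
    rw [← Multiset.coe_toList (numPoly k m a).roots, ← hl, Multiset.map_coe, Multiset.prod_coe,
      ← List.prod_ofFn]
    congr 1
    refine List.ext_get (by simp [hlen]) fun n h1 h2 => ?_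
    simp
  exact varPoly_injective _ (add_left_cancel h1)

theorem analyticOnNhd_coeff_prod {ι : Type*} [Fintype ι] (s : Finset ι) :
    ∀ d, AnalyticOnNhd ℂ
      (fun z : ι → ℂ => (∏ α ∈ s, (X - C (exp (I * z α)))).coeff d) Set.univ := by
  classical
  induction s using Finset.induction_on with
  | empty =>
    intro d
    simp only [Finset.prod_empty]
    exact analyticOnNhd_const
  | insert α s hα ih =>
    intro d
    have hexp : AnalyticOnNhd ℂ (fun z : ι → ℂ => exp (I * z α)) Set.univ := fun z _ => by
      have h1 : AnalyticAt ℂ (fun z : ι → ℂ => z α) z :=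
        (ContinuousLinearMap.proj (R := ℂ) (φ := fun _ : ι => ℂ) α).analyticAt z
      exact (analyticAt_const.mul h1).cexp
    simp only [Finset.prod_insert hα, sub_mul, coeff_sub, coeff_C_mul]
    refine AnalyticOnNhd.sub ?_ (hexp.mul (ih d))
    cases d with
    | zero =>
      simp only [mul_coeff_zero, coeff_X_zero, zero_mul]
      exact analyticOnNhd_const
    | succ d =>
      simp only [coeff_X_mul]
      exact ih d

theorem analyticOnNhd_trigCoeff (k m : ℕ) : AnalyticOnNhd ℂ (trigCoeff k m) Set.univ := by
  intro z hz
  rw [analyticAt_pi_iff]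
  exact fun j => analyticOnNhd_coeff_prod Finset.univ _ z hz

/-- Moving the zero `z_i` changes the numerator of `λ` by `-i e^{iz_i} ∏_{α ≠ i} (X - e^{iz_α})`. -/
theorem varPoly_trigField (k m : ℕ) (z : Fin (k + m) → ℂ) (i : Fin (k + m)) :
    varPoly (k + m) (trigField k m z i) =
      C (-(I * exp (I * z i))) * ∏ α ∈ Finset.univ.erase i, (X - C (exp (I * z α))) := by
  refine Polynomial.funext fun t => ?_
  have hline : HasDerivAt (fun s : ℂ => trigCoeff k m (z + s • Pi.single i 1))
      (trigField k m z i) 0 := by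
    have h1 : HasFDerivAt (trigCoeff k m) (fderiv ℂ (trigCoeff k m) z)
        (z + (0 : ℂ) • Pi.single i 1) := by
      rw [zero_smul, add_zero]
      exact (analyticOnNhd_trigCoeff k m z (Set.mem_univ z)).differentiableAt.hasFDerivAt
    have h2 : HasDerivAt (fun s : ℂ => z + s • (Pi.single i 1 : Fin (k + m) → ℂ))
        (Pi.single i 1) 0 := by
      simpa using ((hasDerivAt_id (0 : ℂ)).smul_const
        (Pi.single i 1 : Fin (k + m) → ℂ)).const_add z
    exact h1.comp_hasDerivAt 0 h2
  let L : (Fin (k + m) → ℂ) →L[ℂ] ℂ :=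
    LinearMap.toContinuousLinearMap ((leval t).comp (varPoly (k + m)))
  have hL : HasDerivAt (fun s : ℂ => L (trigCoeff k m (z + s • Pi.single i 1)))
      (L (trigField k m z i)) 0 := L.hasFDerivAt.comp_hasDerivAt 0 hline
  have hfun : (fun s : ℂ => L (trigCoeff k m (z + s • Pi.single i 1))) = fun s =>
      ∏ α, (t - exp (I * (z α + s * (Pi.single i 1 : Fin (k + m) → ℂ) α))) - t ^ (k + m) := by
    ext s
    have h3 := congrArg (Polynomial.eval t) (numPoly_trigCoeff k m (z + s • Pi.single i 1))
    rw [numPoly, eval_add, eval_pow, eval_X, eval_prod] at h3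
    have h4 : L (trigCoeff k m (z + s • Pi.single i 1)) =
        (varPoly (k + m) (trigCoeff k m (z + s • Pi.single i 1))).eval t := rfl
    rw [h4, eq_sub_iff_add_eq', h3]
    simp
  rw [hfun] at hL
  have hfac : ∀ α ∈ (Finset.univ : Finset (Fin (k + m))),
      HasDerivAt (fun s : ℂ => t - exp (I * (z α + s * (Pi.single i 1 : Fin (k + m) → ℂ) α)))
        (-(exp (I * z α) * (I * (Pi.single i 1 : Fin (k + m) → ℂ) α))) 0 := fun α _ => by
    have h5 := ((((hasDerivAt_id (0 : ℂ)).mul_const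
      ((Pi.single i 1 : Fin (k + m) → ℂ) α)).const_add (z α)).const_mul I).cexp.const_sub t
    simpa using h5
  have hprod := (HasDerivAt.fun_finsetProd hfac).sub_const (t ^ (k + m))
  have h6 := hL.unique hprod
  have h7 : L (trigField k m z i) = (varPoly (k + m) (trigField k m z i)).eval t := rfl
  rw [← h7, h6, Finset.sum_eq_single i]
  · simp [eval_prod]
    ring
  · intro α _ hα
    simp [hα]
  · simp

theorem linearIndependent_trigField {k m : ℕ} {z : Fin (k + m) → ℂ} (hz : z ∈ trigRegular k m) :
    LinearIndependent ℂ (trigField k m z) := by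
  rw [Fintype.linearIndependent_iff]
  intro c hc j
  have h1 := congrArg (fun v => (varPoly (k + m) v).eval (exp (I * z j))) hc
  simp only [map_sum, map_smul, varPoly_trigField, map_zero, eval_finsetSum, eval_smul, eval_mul,
    eval_C, eval_prod, eval_sub, eval_X, eval_zero] at h1
  rw [Finset.sum_eq_single j] at h1
  · rw [smul_eq_zero, mul_eq_zero, Finset.prod_eq_zero_iff] at h1
    rcases h1 with h1 | h1 | ⟨α, hα, h1⟩
    · exact h1
    · simp [I_ne_zero] at h1
    · exact absurd (hz (sub_eq_zero.1 h1)).symm (Finset.ne_of_mem_erase hα)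
  · intro i _ hij
    rw [Finset.prod_eq_zero (i := j) (by simp [hij.symm]) (sub_self _)]
    simp
  · simp

theorem separable_numPoly {k m : ℕ} {z : Fin (k + m) → ℂ} (hz : z ∈ trigRegular k m) :
    (numPoly k m (trigCoeff k m z)).Separable := by
  rw [numPoly_trigCoeff]
  exact separable_prod_X_sub_C_iff.2 hz

end Zeros

/-! ### The intersection form and the dual multiplication in the coordinates `z` -/

namespace TrigModel
variable {k m : ℕ} {a : Fin (k + m) → ℂ} {A : Type*} [CommRing A] [Algebra ℂ A]

theorem trigInter_eq (M : TrigModel k m a A) (u v : Fin (k + m) → ℂ) :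
    trigInter k m a u v = M.ψ (M.ι (trigEulerInv k m a) * M.ι u * M.ι v) := by
  rw [trigInter, M.metric, M.ι_trigMul]

theorem ι_trigStar (M : TrigModel k m a A) (u v : Fin (k + m) → ℂ) :
    M.ι (trigStar k m a u v) = M.ι (trigEulerInv k m a) * M.ι u * M.ι v := by
  rw [trigStar, M.ι_trigMul, M.ι_trigMul, mul_assoc]

end TrigModel

section Fields
open Polynomial

/-- The model of the tangent space at the point with zeros `z`. -/
noncomputable abbrev zeroModel {k m : ℕ} (hk : 1 ≤ k) (hm : 1 ≤ m) (z : Fin (k + m) → ℂ) :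
    TrigModel k m (trigCoeff k m z) (CritAlg k m (trigCoeff k m z)) :=
  critModel hk hm (trigCoeff_mem_trigSpace z)

/-- The functional `ψ` takes the same value on all the coordinate fields `∂_{z_i}`: it is minus the
residue of `∂_{z_i} P dX / (X Q)` at `X = 0`, which does not depend on `i`. -/
theorem ψ_trigField {k m : ℕ} (hk : 1 ≤ k) (hm : 1 ≤ m) (z : Fin (k + m) → ℂ) (i : Fin (k + m)) :
    (zeroModel hk hm z).ψ ((zeroModel hk hm z).ι (trigField k m z i)) = I / m := by
  set a := trigCoeff k m z with ha'
  have ha : a ∈ trigSpace k m := trigCoeff_mem_trigSpace z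
  have hk0 : (k : ℂ) ≠ 0 := by exact_mod_cast (by omega : k ≠ 0)
  have hm0 : (m : ℂ) ≠ 0 := by exact_mod_cast (by omega : m ≠ 0)
  set V := varPoly (k + m) (trigField k m z i) with hV
  -- The residue at `X = 0` is `V(0) / Q(0) = -i / m`.
  set W : ℂ[X] := V + C (I / m) * critPoly k m a with hW
  have hV0 : V.coeff 0 = I * (numPoly k m a).coeff 0 := by
    rw [hV, varPoly_trigField, ha', numPoly_trigCoeff, coeff_zero_eq_eval_zero,
      coeff_zero_eq_eval_zero, ← Finset.mul_prod_erase _ _ (Finset.mem_univ i)]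
    simp
    ring
  have hW0 : W.coeff 0 = 0 := by
    rw [hW, coeff_add, coeff_C_mul, hV0, critPoly_coeff_zero]
    field_simp
    ring
  have hX : X * divX W = W := by
    have := X_mul_divX_add W
    rwa [hW0, C_0, add_zero] at this
  have hmk : AdjoinRoot.mk (rootProd (critPoly k m a).roots) V =
      AdjoinRoot.root _ * AdjoinRoot.mk _ (divX W) := by
    rw [← AdjoinRoot.mk_X, ← map_mul, hX, hW, map_add, map_mul, mk_critPoly hk, mul_zero, add_zero]
  have hVdeg : V.degree < (k + m : ℕ) := varPoly_degree_lt _ _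
  have hdeg : (divX W).degree < (k + m : ℕ) := by
    rw [degree_lt_iff_coeff_zero]
    intro d hd
    rw [coeff_divX, hW, coeff_add, coeff_C_mul,
      coeff_eq_zero_of_degree_lt (hVdeg.trans_le (by exact_mod_cast (by omega : k + m ≤ d + 1))),
      coeff_eq_zero_of_natDegree_lt (by rw [critPoly_natDegree hk]; omega)]
    simp
  have hcoeff : (divX W).coeff (k + m - 1) = I / m * k := by
    rw [coeff_divX, show k + m - 1 + 1 = k + m by omega, hW, coeff_add, coeff_C_mul,
      critPoly_coeff_top, coeff_eq_zero_of_degree_lt hVdeg, zero_add]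
  have hxy := root_mul_critInv hk hm ha
  rw [critModel_ψ, critModel_ι, ← hV]
  have h1 : critInv k m a * AdjoinRoot.root _ ^ m *
      (critInv k m a ^ m * AdjoinRoot.mk _ V) = AdjoinRoot.mk _ (divX W) := by
    calc _ = (AdjoinRoot.root _ * critInv k m a) ^ (m + 1) *
          AdjoinRoot.mk (rootProd (critPoly k m a).roots) (divX W) := by rw [hmk]; ring
      _ = _ := by rw [hxy, one_pow, one_mul]
  rw [h1, critTrace_mk_of_degree_lt hk a hdeg, hcoeff]
  field_simp

/-- On the critical scheme, `∂_{z_i} λ = -i e^{iz_i} λ / (X - e^{iz_i})`. -/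
theorem ι_trigField_mul {k m : ℕ} (hk : 1 ≤ k) (hm : 1 ≤ m)
    (z : Fin (k + m) → ℂ) (i : Fin (k + m)) :
    (zeroModel hk hm z).ι (trigField k m z i) *
        ((AdjoinRoot.root _ : CritAlg k m (trigCoeff k m z)) - algebraMap ℂ _ (exp (I * z i))) =
      algebraMap ℂ _ (-(I * exp (I * z i))) *
        (zeroModel hk hm z).ι (trigEuler k m (trigCoeff k m z)) := by
  rw [critModel_ι_euler, critModel_ι, varPoly_trigField, AdjoinRoot.algebraMap_eq,
    ← AdjoinRoot.mk_X, ← AdjoinRoot.mk_C, ← AdjoinRoot.mk_C, ← map_sub, mul_assoc, ← map_mul,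
    mul_left_comm, ← map_mul, numPoly_trigCoeff, ← Finset.prod_erase_mul _ _ (Finset.mem_univ i),
    mul_assoc]

/-- A simultaneous translation of all the zeros is, up to a rescaling of `λ`, a translation of `p`;
hence the fields `∂_{z_i}` add up to a multiple of the Euler field. -/
theorem sum_ι_trigField {k m : ℕ} (hk : 1 ≤ k) (hm : 1 ≤ m) (z : Fin (k + m) → ℂ) :
    ∑ i, (zeroModel hk hm z).ι (trigField k m z i) =
      algebraMap ℂ _ (I * k) * (zeroModel hk hm z).ι (trigEuler k m (trigCoeff k m z)) := by
  have hpoly : ∑ i, varPoly (k + m) (trigField k m z i) =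
      C (I * k) * numPoly k m (trigCoeff k m z) - C I * critPoly k m (trigCoeff k m z) := by
    have hd : derivative (numPoly k m (trigCoeff k m z)) =
        ∑ i, ∏ α ∈ Finset.univ.erase i, (X - C (exp (I * z α))) := by
      rw [numPoly_trigCoeff, derivative_prod_finset]
      simp
    have hi : ∀ i, varPoly (k + m) (trigField k m z i) = C I *
        (numPoly k m (trigCoeff k m z) -
          X * ∏ α ∈ Finset.univ.erase i, (X - C (exp (I * z α)))) := fun i => by
      rw [varPoly_trigField, numPoly_trigCoeff, ← Finset.mul_prod_erase _ _ (Finset.mem_univ i),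
        C_neg, C_mul]
      ring
    simp only [hi]
    rw [← Finset.mul_sum, Finset.sum_sub_distrib, ← Finset.mul_sum, ← hd, critPoly]
    simp
    ring
  rw [critModel_ι_euler]
  simp only [critModel_ι]
  rw [← Finset.mul_sum, ← map_sum, hpoly, map_sub, map_mul _ (C (I * k)),
    map_mul _ (C I), mk_critPoly hk, mul_zero,
    sub_zero, AdjoinRoot.mk_C, AdjoinRoot.algebraMap_eq]
  ring

theorem ι_trigEulerInv_mul_euler {k m : ℕ} (hk : 1 ≤ k) (hm : 1 ≤ m)
    {z : Fin (k + m) → ℂ} (hz : z ∈ trigRegular k m) :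
    (zeroModel hk hm z).ι (trigEulerInv k m (trigCoeff k m z)) *
      (zeroModel hk hm z).ι (trigEuler k m (trigCoeff k m z)) = 1 :=
  (zeroModel hk hm z).ι_trigEulerInv_mul (critModel_ι_unit hk hm _)
    (isUnit_critModel_ι_euler hk hm _ (separable_numPoly hz))

theorem trigMul_trigEulerInv {k m : ℕ} (hk : 1 ≤ k) (hm : 1 ≤ m)
    {z : Fin (k + m) → ℂ} (hz : z ∈ trigRegular k m) :
    trigMul k m (trigCoeff k m z) (trigEulerInv k m (trigCoeff k m z))
      (trigEuler k m (trigCoeff k m z)) = trigUnit k m := by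
  apply (zeroModel hk hm z).ι.injective
  rw [(zeroModel hk hm z).ι_trigMul, ι_trigEulerInv_mul_euler hk hm hz, critModel_ι_unit]

/-- The dual product of two coordinate fields, by the partial fraction expansion of
`1 / ((X - e^{iz_i}) (X - e^{iz_j}))`. -/
theorem trigStar_trigField {k m : ℕ} (hk : 1 ≤ k) (hm : 1 ≤ m)
    {z : Fin (k + m) → ℂ} (hz : z ∈ trigRegular k m) (i j : Fin (k + m)) :
    (exp (I * z j) - exp (I * z i)) •
        trigStar k m (trigCoeff k m z) (trigField k m z i) (trigField k m z j) =
      I • (exp (I * z j) • trigField k m z i - exp (I * z i) • trigField k m z j) := by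
  apply (zeroModel hk hm z).ι.injective
  have hF := ι_trigEulerInv_mul_euler hk hm hz
  have hi := ι_trigField_mul hk hm z i
  have hj := ι_trigField_mul hk hm z j
  simp only [map_smul, map_sub, (zeroModel hk hm z).ι_trigStar]
  simp only [Algebra.smul_def, map_sub]
  rw [map_neg, map_mul] at hi hj
  linear_combination
    (zeroModel hk hm z).ι (trigEulerInv k m (trigCoeff k m z)) *
      (zeroModel hk hm z).ι (trigField k m z j) * hi -
    (zeroModel hk hm z).ι (trigEulerInv k m (trigCoeff k m z)) *
      (zeroModel hk hm z).ι (trigField k m z i) * hj +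
    algebraMap ℂ _ I *
      (algebraMap ℂ _ (exp (I * z j)) * (zeroModel hk hm z).ι (trigField k m z i) -
      algebraMap ℂ _ (exp (I * z i)) * (zeroModel hk hm z).ι (trigField k m z j)) * hF

theorem sum_trigStar_trigField {k m : ℕ} (hk : 1 ≤ k) (hm : 1 ≤ m)
    {z : Fin (k + m) → ℂ} (hz : z ∈ trigRegular k m) (i : Fin (k + m)) :
    ∑ j, trigStar k m (trigCoeff k m z) (trigField k m z i) (trigField k m z j) =
      (I * k) • trigField k m z i := by
  apply (zeroModel hk hm z).ι.injective
  have hF := ι_trigEulerInv_mul_euler hk hm hz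
  rw [map_sum, map_smul, Algebra.smul_def]
  simp only [(zeroModel hk hm z).ι_trigStar]
  rw [← Finset.mul_sum, sum_ι_trigField]
  linear_combination algebraMap ℂ _ (I * k) * (zeroModel hk hm z).ι (trigField k m z i) * hF

theorem trigInter_linear_left {k m : ℕ} (hk : 1 ≤ k) (hm : 1 ≤ m)
    (z : Fin (k + m) → ℂ) (v : Fin (k + m) → ℂ) :
    ∃ L : (Fin (k + m) → ℂ) →ₗ[ℂ] ℂ, ∀ u, trigInter k m (trigCoeff k m z) u v = L u := by
  refine ⟨(zeroModel hk hm z).ψ ∘ₗ LinearMap.mulRight ℂ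
    ((zeroModel hk hm z).ι (trigEulerInv k m (trigCoeff k m z)) *
    (zeroModel hk hm z).ι v) ∘ₗ (zeroModel hk hm z).ι.toLinearMap, fun u => ?_⟩
  rw [(zeroModel hk hm z).trigInter_eq]
  simp only [LinearMap.comp_apply, LinearMap.mulRight_apply, LinearEquiv.coe_coe]
  congr 1
  ring

/-- The intersection form in the coordinates `z`. -/
theorem trigInter_trigField {k m : ℕ} (hk : 1 ≤ k) (hm : 1 ≤ m)
    {z : Fin (k + m) → ℂ} (hz : z ∈ trigRegular k m) (i j : Fin (k + m)) :
    trigInter k m (trigCoeff k m z) (trigField k m z i) (trigField k m z j) =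
      (if i = j then 1 else 0) - 1 / m := by
  have hm0 : (m : ℂ) ≠ 0 := by exact_mod_cast (by omega : m ≠ 0)
  have hS : ∀ i j, trigInter k m (trigCoeff k m z) (trigField k m z i) (trigField k m z j) =
      (zeroModel hk hm z).ψ ((zeroModel hk hm z).ι
        (trigStar k m (trigCoeff k m z) (trigField k m z i) (trigField k m z j))) := fun i j => by
    rw [(zeroModel hk hm z).trigInter_eq, (zeroModel hk hm z).ι_trigStar]
  have hne : ∀ i j, i ≠ j →
      trigInter k m (trigCoeff k m z) (trigField k m z i) (trigField k m z j) = -1 / m := by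
    intro i j hij
    have h0 : exp (I * z j) - exp (I * z i) ≠ 0 := sub_ne_zero.2 fun h => hij (hz h).symm
    have h1 := congrArg (fun v => (zeroModel hk hm z).ψ ((zeroModel hk hm z).ι v))
      (trigStar_trigField hk hm hz i j)
    simp only [map_smul, map_sub, ← hS, ψ_trigField, smul_eq_mul] at h1
    apply mul_left_cancel₀ h0
    rw [h1]
    linear_combination (exp (I * z j) - exp (I * z i)) / m * I_mul_I
  split_ifs with h
  · subst h
    have h1 := congrArg (fun v => (zeroModel hk hm z).ψ ((zeroModel hk hm z).ι v))
      (sum_trigStar_trigField hk hm hz i)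
    simp only [map_smul, map_sum, ← hS, ψ_trigField, smul_eq_mul] at h1
    rw [← Finset.add_sum_erase _ _ (Finset.mem_univ i),
      Finset.sum_congr rfl fun j hj => hne i j (Finset.ne_of_mem_erase hj).symm, Finset.sum_const,
      Finset.card_erase_of_mem (Finset.mem_univ i), Finset.card_univ, Fintype.card_fin,
      nsmul_eq_mul, Nat.cast_sub (by omega)] at h1
    rw [eq_sub_of_add_eq h1]
    push_cast
    field_simp
    linear_combination (k : ℂ) * I_mul_I
  · rw [hne i j h]
    ring

end Fields

/-! ### Branches of the trilogarithm -/

/-- The operator `θ = x d/dx`. -/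
noncomputable def theta (f : ℂ → ℂ) (x : ℂ) : ℂ := x * deriv f x

theorem theta_congr {f g : ℂ → ℂ} {x : ℂ} (h : f =ᶠ[𝓝 x] g) : theta f =ᶠ[𝓝 x] theta g := by
  filter_upwards [h.eventuallyEq_nhds] with y hy
  rw [theta, theta, hy.deriv_eq]

theorem AnalyticAt.theta {f : ℂ → ℂ} {x : ℂ} (h : AnalyticAt ℂ f x) : AnalyticAt ℂ (theta f) x :=
  analyticAt_id.mul h.deriv

theorem theta_const_mul (c : ℂ) (f : ℂ → ℂ) :
    theta (fun x => c * f x) = fun x => c * theta f x := by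
  ext x
  rw [theta, theta, deriv_const_mul_field]
  ring

theorem hasDerivAt_tsum_polylog (s : ℕ) {x : ℂ} (hx : ‖x‖ < 1) :
    HasDerivAt (fun x : ℂ => ∑' n : ℕ, x ^ (n + 1) / ((n : ℂ) + 1) ^ (s + 1))
      (∑' n : ℕ, x ^ n / ((n : ℂ) + 1) ^ s) x := by
  obtain ⟨r, hxr, hr1⟩ := exists_between hx
  have hr0 : 0 ≤ r := (norm_nonneg x).trans hxr.le
  have hn : ∀ n : ℕ, (n : ℂ) + 1 ≠ 0 := fun n => by exact_mod_cast n.succ_ne_zero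
  refine hasDerivAt_tsum_of_isPreconnected (𝕜 := ℂ) (u := fun n : ℕ => r ^ n)
    (g := fun (n : ℕ) (x : ℂ) => x ^ (n + 1) / ((n : ℂ) + 1) ^ (s + 1))
    (g' := fun (n : ℕ) (x : ℂ) => x ^ n / ((n : ℂ) + 1) ^ s) (t := Metric.ball 0 r) (y₀ := 0)
    (summable_geometric_of_lt_one hr0 hr1) Metric.isOpen_ball
    (convex_ball 0 r).isPreconnected (fun n y _ => ?_) (fun n y hy => ?_)
    (Metric.mem_ball_self ((norm_nonneg x).trans_lt hxr)) ?_ (by simpa using hxr)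
  · refine ((hasDerivAt_pow (n + 1) y).div_const (((n : ℂ) + 1) ^ (s + 1))).congr_deriv ?_
    have := hn n
    push_cast
    field_simp
    ring
  · have hy : ‖y‖ < r := by simpa using hy
    have h1 : (1 : ℝ) ≤ ‖((n : ℂ) + 1) ^ s‖ := by
      rw [norm_pow]
      refine one_le_pow₀ ?_
      have : ((n : ℂ) + 1) = ((n + 1 : ℕ) : ℂ) := by push_cast; ring
      rw [this, Complex.norm_natCast]
      exact_mod_cast Nat.succ_le_succ n.zero_le
    rw [norm_div, norm_pow]
    calc ‖y‖ ^ n / ‖((n : ℂ) + 1) ^ s‖ ≤ ‖y‖ ^ n := div_le_self (by positivity) h1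
      _ ≤ r ^ n := by gcongr
  · simp

theorem theta_tsum_polylog (s : ℕ) {x : ℂ} (hx : ‖x‖ < 1) :
    theta (fun x : ℂ => ∑' n : ℕ, x ^ (n + 1) / ((n : ℂ) + 1) ^ (s + 1)) x =
      ∑' n : ℕ, x ^ (n + 1) / ((n : ℂ) + 1) ^ s := by
  rw [theta, (hasDerivAt_tsum_polylog s hx).deriv, ← tsum_mul_left]
  refine tsum_congr fun n => ?_
  ring

theorem analyticOnNhd_tsum_polylog (s : ℕ) :
    AnalyticOnNhd ℂ (fun x : ℂ => ∑' n : ℕ, x ^ (n + 1) / ((n : ℂ) + 1) ^ (s + 1))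
      (Metric.ball 0 1) := by
  refine DifferentiableOn.analyticOnNhd (fun x hx => ?_) Metric.isOpen_ball
  exact (hasDerivAt_tsum_polylog s (by simpa using hx)).differentiableAt.differentiableWithinAt

theorem theta_cube_trilog {x : ℂ} (hx : ‖x‖ < 1) :
    (1 - x) * theta (theta (theta
      fun x : ℂ => ∑' n : ℕ, x ^ (n + 1) / ((n : ℂ) + 1) ^ 3)) x = x := by
  have hev : ∀ s : ℕ, ∀ y : ℂ, ‖y‖ < 1 →
      theta (fun x : ℂ => ∑' n : ℕ, x ^ (n + 1) / ((n : ℂ) + 1) ^ (s + 1)) =ᶠ[𝓝 y]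
      fun x : ℂ => ∑' n : ℕ, x ^ (n + 1) / ((n : ℂ) + 1) ^ s := fun s y hy => by
    filter_upwards [Metric.isOpen_ball.mem_nhds (show y ∈ Metric.ball (0 : ℂ) 1 by simpa using hy)]
      with w hw
    exact theta_tsum_polylog s (by simpa using hw)
  have h2 := ((theta_congr (theta_congr (hev 2 x hx))).trans (theta_congr (hev 1 x hx))).trans
    (hev 0 x hx)
  rw [h2.eq_of_nhds]
  simp only [pow_zero, div_one, pow_succ]
  rw [tsum_mul_right, tsum_geometric_of_norm_lt_one hx]
  have : 1 - x ≠ 0 := by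
    intro h
    rw [← sub_eq_zero.1 h] at hx
    simp at hx
  field_simp

/-- Every branch of the trilogarithm is analytic and satisfies `θ³ Li₃ = x / (1 - x)`: the equation
holds on the unit disc and persists under analytic continuation by the identity theorem. -/
theorem IsTrilog.analytic_and_theta {f : ℂ → ℂ} {U : Set ℂ} (h : IsTrilog f U) :
    IsOpen U ∧ AnalyticOnNhd ℂ f U ∧ ∀ x ∈ U, (1 - x) * theta (theta (theta f)) x = x := by
  induction h with
  | base =>
    exact ⟨Metric.isOpen_ball, analyticOnNhd_tsum_polylog 2, fun x hx =>
      theta_cube_trilog (by simpa using hx)⟩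
  | @step f g U V x hf hV hc hg hxU hxV h ih =>
    obtain ⟨hU, -, hode⟩ := ih
    refine ⟨hV, hg, fun y hy => ?_⟩
    have hana : AnalyticOnNhd ℂ (fun y => (1 - y) * theta (theta (theta g)) y - y) V := fun y hy =>
      ((analyticAt_const.sub analyticAt_id).mul (hg y hy).theta.theta.theta).sub analyticAt_id
    have hzero : (fun y => (1 - y) * theta (theta (theta g)) y - y) =ᶠ[𝓝 x] 0 := by
      filter_upwards [hU.mem_nhds hxU, theta_congr (theta_congr (theta_congr h))] with y hyU hy
      rw [← hy, hode y hyU, sub_self, Pi.zero_apply]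
    exact sub_eq_zero.1 (hana.eqOn_zero_of_preconnected_of_eventuallyEq_zero hc hxV hzero hy)

theorem eventuallyEq_of_hasDerivAt {f g h : ℂ → ℂ} {y : ℂ}
    (hf : ∀ᶠ x in 𝓝 y, HasDerivAt f (h x) x) (hg : ∀ᶠ x in 𝓝 y, HasDerivAt g (h x) x)
    (hy : f y = g y) : f =ᶠ[𝓝 y] g := by
  obtain ⟨ε, hε, hb⟩ := Metric.eventually_nhds_iff_ball.1 (hf.and hg)
  refine Filter.eventuallyEq_of_mem (Metric.ball_mem_nhds y hε) ?_
  refine Metric.isOpen_ball.eqOn_of_deriv_eq (convex_ball y ε).isPreconnected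
    (fun x hx => (hb x hx).1.differentiableAt.differentiableWithinAt)
    (fun x hx => (hb x hx).2.differentiableAt.differentiableWithinAt)
    (fun x hx => ?_) (Metric.mem_ball_self hε) hy
  rw [(hb x hx).1.deriv, (hb x hx).2.deriv]

/-- A branch of the trilogarithm continues to every disc that meets its domain and avoids `0` and
`1`: the equation `θ³ f = x / (1 - x)` is integrated three times there. -/
theorem IsTrilog.exists_continuation {f : ℂ → ℂ} {U : Set ℂ} (h : IsTrilog f U) {c y : ℂ} {r : ℝ}
    (hyU : y ∈ U) (hy : y ∈ Metric.ball c r) (h0 : (0 : ℂ) ∉ Metric.ball c r)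
    (h1 : (1 : ℂ) ∉ Metric.ball c r) : ∃ g, IsTrilog g (Metric.ball c r) := by
  obtain ⟨hU, hf, hode⟩ := h.analytic_and_theta
  have hne0 : ∀ x ∈ Metric.ball c r, x ≠ 0 := fun x hx h => h0 (h ▸ hx)
  have hne1 : ∀ x ∈ Metric.ball c r, 1 - x ≠ 0 := fun x hx h => h1 (sub_eq_zero.1 h ▸ hx)
  have hprim : ∀ (φ : ℂ → ℂ) (v : ℂ), DifferentiableOn ℂ φ (Metric.ball c r) →
      ∃ g : ℂ → ℂ, g y = v ∧ ∀ x ∈ Metric.ball c r, HasDerivAt g (φ x) x := fun φ v hφ => by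
    simpa using hφ.isExactOn_ball.with_val_at y v
  have hdiff : ∀ {g φ : ℂ → ℂ}, (∀ x ∈ Metric.ball c r, HasDerivAt g (φ x) x) →
      DifferentiableOn ℂ g (Metric.ball c r) := fun hg x hx =>
    (hg x hx).differentiableAt.differentiableWithinAt
  obtain ⟨g₂, hg₂y, hg₂⟩ := hprim (fun x => (1 - x)⁻¹) (theta (theta f) y)
    (((differentiableOn_const 1).sub differentiableOn_id).inv hne1)
  obtain ⟨g₁, hg₁y, hg₁⟩ := hprim (fun x => g₂ x / x) (theta f y)
    ((hdiff hg₂).div differentiableOn_id hne0)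
  obtain ⟨g, hgy, hg⟩ := hprim (fun x => g₁ x / x) (f y) ((hdiff hg₁).div differentiableOn_id hne0)
  have hball := Metric.isOpen_ball.mem_nhds hy
  have hderiv : ∀ {φ : ℂ → ℂ} {x : ℂ}, x ≠ 0 → AnalyticAt ℂ φ x →
      HasDerivAt φ (theta φ x / x) x := fun {φ x} hx hφ => by
    rw [theta, mul_div_cancel_left₀ _ hx]
    exact hφ.differentiableAt.hasDerivAt
  have e₂ : theta (theta f) =ᶠ[𝓝 y] g₂ := by
    refine eventuallyEq_of_hasDerivAt (h := fun x => (1 - x)⁻¹) ?_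
      (eventually_of_mem hball hg₂) hg₂y.symm
    filter_upwards [hball, hU.mem_nhds hyU] with x hx hxU
    refine (hderiv (hne0 x hx) (hf x hxU).theta.theta).congr_deriv ?_
    rw [div_eq_iff (hne0 x hx), eq_comm, inv_mul_eq_iff_eq_mul₀ (hne1 x hx)]
    exact (hode x hxU).symm
  have e₁ : theta f =ᶠ[𝓝 y] g₁ := by
    refine eventuallyEq_of_hasDerivAt (h := fun x => g₂ x / x) ?_
      (eventually_of_mem hball hg₁) hg₁y.symm
    filter_upwards [hball, hU.mem_nhds hyU, e₂] with x hx hxU hx₂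
    rw [← hx₂]
    exact hderiv (hne0 x hx) (hf x hxU).theta
  have e₀ : f =ᶠ[𝓝 y] g := by
    refine eventuallyEq_of_hasDerivAt (h := fun x => g₁ x / x) ?_
      (eventually_of_mem hball hg) hgy.symm
    filter_upwards [hball, hU.mem_nhds hyU, e₁] with x hx hxU hx₁
    rw [← hx₁]
    exact hderiv (hne0 x hx) (hf x hxU)
  exact ⟨g, h.step Metric.isOpen_ball (convex_ball c r).isPreconnected
    ((hdiff hg).analyticOnNhd Metric.isOpen_ball) hyU hy e₀⟩

theorem mem_ball_mul_I_iff {x : ℂ} {R : ℝ} (hR : 0 < R) (σ : ℝ) (hσ : σ ^ 2 = 1) :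
    x ∈ Metric.ball ((σ * R : ℝ) * I) R ↔ x.re ^ 2 + x.im ^ 2 < 2 * R * (σ * x.im) := by
  rw [Metric.mem_ball, dist_eq, ← abs_of_pos hR, ← abs_norm, ← sq_lt_sq, abs_of_pos hR,
    Complex.sq_norm, normSq_apply]
  simp only [sub_re, sub_im, mul_re, mul_im, ofReal_re, ofReal_im, I_re, I_im]
  constructor <;> intro h <;> nlinarith

theorem exists_isTrilog_ball_mul_I {R : ℝ} (hR : 1 ≤ R) (σ : ℝ) (hσ : σ ^ 2 = 1) :
    ∃ g, IsTrilog g (Metric.ball ((σ * R : ℝ) * I) R) := by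
  have hR0 : 0 < R := by linarith
  refine IsTrilog.base.exists_continuation (y := (σ / 2 : ℝ) * I) ?_ ?_ ?_ ?_
  · rw [mem_ball_zero_iff, norm_mul, norm_I, mul_one, norm_real, Real.norm_eq_abs, abs_lt]
    constructor <;> nlinarith
  · rw [mem_ball_mul_I_iff hR0 σ hσ]
    simp only [mul_re, mul_im, ofReal_re, ofReal_im, I_re, I_im]
    nlinarith
  · rw [mem_ball_mul_I_iff hR0 σ hσ]
    simp
  · rw [mem_ball_mul_I_iff hR0 σ hσ]
    simp

/-- Branches of the trilogarithm exist near every point other than `0` and `1`. Off the real axis, one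
disc in a half-plane, tangent to the axis at `0`, leads from the unit disc to the point; the negative
axis is reached directly and the ray `x > 1` through such a disc. -/
theorem exists_isTrilog {x : ℂ} (h0 : x ≠ 0) (h1 : x ≠ 1) : ∃ f U, IsTrilog f U ∧ x ∈ U := by
  have hhalf : ∀ (w : ℂ) (σ : ℝ), σ ^ 2 = 1 → 0 < σ * w.im → ∃ (f : ℂ → ℂ) (R : ℝ),
      IsTrilog f (Metric.ball ((σ * R : ℝ) * I) R) ∧ w ∈ Metric.ball ((σ * R : ℝ) * I) R := by
    intro w σ hσ hw
    -- The disc `|x - σRi| < R` is the set `|x|² < 2Rσ Im x`, so a large `R` is enough.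
    set R := 1 + (w.re ^ 2 + w.im ^ 2) / (σ * w.im) with hRdef
    have hR : 1 ≤ R := by
      rw [hRdef]
      have : 0 ≤ (w.re ^ 2 + w.im ^ 2) / (σ * w.im) := by positivity
      linarith
    have hmem : w ∈ Metric.ball ((σ * R : ℝ) * I) R := by
      rw [mem_ball_mul_I_iff (by linarith) σ hσ]
      have : R * (σ * w.im) = σ * w.im + (w.re ^ 2 + w.im ^ 2) := by
        rw [hRdef, add_mul, div_mul_cancel₀ _ hw.ne', one_mul]
      nlinarith [sq_nonneg w.re, sq_nonneg w.im]
    obtain ⟨g, hg⟩ := exists_isTrilog_ball_mul_I hR σ hσ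
    exact ⟨g, R, hg, hmem⟩
  rcases lt_trichotomy x.im 0 with him | him | him
  · obtain ⟨f, R, hf, hx⟩ := hhalf x (-1) (by norm_num) (by linarith)
    exact ⟨f, _, hf, hx⟩
  · obtain ⟨t, rfl⟩ : ∃ t : ℝ, x = t := ⟨x.re, Complex.ext rfl (by simpa using him)⟩
    have ht0 : t ≠ 0 := fun h => h0 (by rw [h, ofReal_zero])
    have ht1 : t ≠ 1 := fun h => h1 (by rw [h, ofReal_one])
    have hdist : ∀ (s : ℝ) (r : ℝ), ((s : ℝ) : ℂ) ∈ Metric.ball (t : ℂ) r ↔ |s - t| < r := by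
      intro s r
      rw [Metric.mem_ball, dist_eq, ← ofReal_sub, norm_real, Real.norm_eq_abs]
    rcases lt_or_gt_of_ne ht0 with hneg | hpos
    · have hmem : (t : ℂ) ∈ Metric.ball (t : ℂ) (-t) := Metric.mem_ball_self (by linarith)
      -- A point of the negative axis in the unit disc and in the disc around `t` tangent at `0`.
      obtain ⟨y, hy, hy'⟩ : ∃ y : ℝ, |y| < 1 ∧ |y - t| < -t := by
        rcases le_or_gt t (-1) with h | h
        · exact ⟨-1 / 2, by rw [abs_lt]; constructor <;> linarith,
            by rw [abs_lt]; constructor <;> linarith⟩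
        · exact ⟨t, by rw [abs_lt]; constructor <;> linarith, by simpa using hneg⟩
      obtain ⟨g, hg⟩ := IsTrilog.base.exists_continuation (y := (y : ℂ)) (c := t) (r := -t)
        (by simpa using hy) ((hdist _ _).2 hy')
        (by rw [← ofReal_zero, hdist, zero_sub, abs_neg, abs_of_neg hneg]; exact lt_irrefl _)
        (by rw [← ofReal_one, hdist, abs_of_pos (by linarith)]; linarith)
      exact ⟨g, _, hg, hmem⟩
    · rcases lt_or_gt_of_ne ht1 with hlt | hgt
      · exact ⟨_, _, IsTrilog.base, by simpa [abs_of_pos hpos] using hlt⟩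
      · have hmem : (t : ℂ) ∈ Metric.ball (t : ℂ) (t - 1) := Metric.mem_ball_self (by linarith)
        -- The disc around `t` tangent at `1` contains this point of the upper half-plane.
        set y : ℂ := t + ((t - 1) / 2 : ℝ) * I with hy
        obtain ⟨f, R, hf, hyR⟩ := hhalf y 1 (by norm_num) (by simp [hy]; linarith)
        obtain ⟨g, hg⟩ := hf.exists_continuation (c := t) (r := t - 1) hyR
          (by
            rw [Metric.mem_ball, dist_eq, hy, add_sub_cancel_left, norm_mul, norm_I, norm_real,
              Real.norm_eq_abs, abs_of_pos (by linarith)]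
            linarith)
          (by rw [← ofReal_zero, hdist, zero_sub, abs_neg, abs_of_pos hpos]; linarith)
          (by rw [← ofReal_one, hdist, abs_of_neg (by linarith)]; linarith)
        exact ⟨g, _, hg, hmem⟩
  · obtain ⟨f, R, hf, hx⟩ := hhalf x 1 (by norm_num) (by linarith)
    exact ⟨f, _, hf, hx⟩

/-! ### Partial derivatives of the prepotential -/

/-- `HasPD c F v w`: the function `F` is differentiable at `w`, with partial derivative
`∂F/∂w_c = v`. -/
def HasPD {n : ℕ} (c : Fin n) (F : (Fin n → ℂ) → ℂ) (v : ℂ) (w : Fin n → ℂ) : Prop :=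
  DifferentiableAt ℂ F w ∧ pderivAt c F w = v

namespace HasPD
variable {n : ℕ} {c : Fin n} {F G : (Fin n → ℂ) → ℂ} {u v : ℂ} {w : Fin n → ℂ}

theorem of_hasFDerivAt {F' : (Fin n → ℂ) →L[ℂ] ℂ} (h : HasFDerivAt F F' w)
    (hv : F' (Pi.single c 1) = v) : HasPD c F v w :=
  ⟨h.differentiableAt, by rw [pderivAt, h.fderiv, hv]⟩

theorem hasFDerivAt (h : HasPD c F v w) : HasFDerivAt F (fderiv ℂ F w) w := h.1.hasFDerivAt

theorem congr_value (h : HasPD c F u w) (huv : u = v) : HasPD c F v w := huv ▸ h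

theorem const (b : ℂ) : HasPD c (fun _ => b) 0 w :=
  of_hasFDerivAt (hasFDerivAt_const b w) rfl

theorem coord (i : Fin n) : HasPD c (fun w => w i) (if i = c then 1 else 0) w :=
  of_hasFDerivAt (ContinuousLinearMap.proj (R := ℂ) (φ := fun _ : Fin n => ℂ) i).hasFDerivAt
    (by simp [Pi.single_apply])

theorem add (hF : HasPD c F u w) (hG : HasPD c G v w) : HasPD c (fun w => F w + G w) (u + v) w :=
  of_hasFDerivAt (hF.hasFDerivAt.add hG.hasFDerivAt) (congrArg₂ (· + ·) hF.2 hG.2)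

theorem mul (hF : HasPD c F u w) (hG : HasPD c G v w) :
    HasPD c (fun w => F w * G w) (F w * v + G w * u) w :=
  of_hasFDerivAt (hF.hasFDerivAt.mul hG.hasFDerivAt) (by
    have h1 : fderiv ℂ F w (Pi.single c 1) = u := hF.2
    have h2 : fderiv ℂ G w (Pi.single c 1) = v := hG.2
    simp [h1, h2])

theorem const_mul (hF : HasPD c F u w) (b : ℂ) : HasPD c (fun w => b * F w) (b * u) w :=
  ((const b).mul hF).congr_value (by ring)

theorem sum {ι : Type*} {s : Finset ι} {F : ι → (Fin n → ℂ) → ℂ} {v : ι → ℂ}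
    (h : ∀ i ∈ s, HasPD c (F i) (v i) w) : HasPD c (fun w => ∑ i ∈ s, F i w) (∑ i ∈ s, v i) w :=
  of_hasFDerivAt (HasFDerivAt.fun_sum fun i hi => (h i hi).hasFDerivAt) (by
    rw [sum_apply]
    exact Finset.sum_congr rfl fun i hi => (h i hi).2)

/-- On functions of `e^{i(w_i - w_j)}` the partial derivatives act through `θ = x d/dx`. -/
theorem comp_exp_sub {K : ℂ → ℂ} {i j : Fin n} (hK : AnalyticAt ℂ K (exp (I * (w i - w j)))) :
    HasPD c (fun w => K (exp (I * (w i - w j))))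
      (I * ((if i = c then 1 else 0) - if j = c then 1 else 0) *
        theta K (exp (I * (w i - w j)))) w := by
  have h1 : HasFDerivAt (fun w : Fin n → ℂ => w i - w j)
      (ContinuousLinearMap.proj (R := ℂ) (φ := fun _ : Fin n => ℂ) i -
        ContinuousLinearMap.proj (R := ℂ) (φ := fun _ : Fin n => ℂ) j) w :=
    (ContinuousLinearMap.proj (R := ℂ) (φ := fun _ : Fin n => ℂ) i -
        ContinuousLinearMap.proj (R := ℂ) (φ := fun _ : Fin n => ℂ) j).hasFDerivAt
  have h2 := (h1.const_mul I).cexp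
  refine of_hasFDerivAt
    (hK.differentiableAt.hasDerivAt.comp_hasFDerivAt (f := fun w : Fin n → ℂ =>
      exp (I * (w i - w j))) w h2) ?_
  simp [theta, Pi.single_apply]
  ring

theorem pderivAt_congr (h : F =ᶠ[𝓝 w] G) : pderivAt c F w = pderivAt c G w := by
  rw [pderivAt, pderivAt, h.fderiv_eq]

theorem coord_sum : HasPD c (fun w => ∑ i, w i) 1 w :=
  (sum fun i _ => coord i).congr_value (by simp)

theorem coord_sq (i : Fin n) :
    HasPD c (fun w => w i ^ 2) (2 * w i * if i = c then 1 else 0) w := by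
  have h := (coord (c := c) (w := w) i).mul (coord i)
  simp only [← pow_two] at h
  exact h.congr_value (by ring)

theorem coord_sq_sum : HasPD c (fun w => ∑ i, w i ^ 2) (2 * w c) w :=
  (sum fun i _ => coord_sq i).congr_value (by simp)

theorem coord_cube_sum : HasPD c (fun w => ∑ i, w i ^ 3) (3 * w c ^ 2) w := by
  have h : ∀ i ∈ Finset.univ, HasPD c (fun w : Fin n → ℂ => w i ^ 3)
      (3 * w i ^ 2 * if i = c then 1 else 0) w := fun i _ => by
    have h1 := (coord_sq (c := c) (w := w) i).mul (coord i)
    simp only [← pow_succ] at h1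
    exact h1.congr_value (by ring)
  exact (sum h).congr_value (by simp)

end HasPD

theorem sum_Ioi_mul {n : ℕ} (z : Fin n → ℂ) :
    2 * ∑ i, ∑ j ∈ Finset.Ioi i, z i * z j = (∑ i, z i) ^ 2 - ∑ i, z i ^ 2 := by
  induction n with
  | zero => simp
  | succ n ih =>
    have := ih (fun i => z i.succ)
    simp only [Fin.sum_univ_succ, Fin.sum_Ioi_zero, Fin.sum_Ioi_succ, ← Finset.mul_sum] at this ⊢
    linear_combination this

theorem sum_Ioi_mul_mul {n : ℕ} (z : Fin n → ℂ) :
    6 * ∑ i, ∑ j ∈ Finset.Ioi i, ∑ l ∈ Finset.Ioi j, z i * z j * z l =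
      (∑ i, z i) ^ 3 - 3 * (∑ i, z i) * (∑ i, z i ^ 2) + 2 * ∑ i, z i ^ 3 := by
  induction n with
  | zero => simp
  | succ n ih =>
    have h3 := ih (fun i => z i.succ)
    have h2 := sum_Ioi_mul (fun i => z i.succ)
    have hz : ∑ i : Fin n, ∑ j ∈ Finset.Ioi i, z 0 * z i.succ * z j.succ =
        z 0 * ∑ i : Fin n, ∑ j ∈ Finset.Ioi i, z i.succ * z j.succ := by
      simp only [Finset.mul_sum, mul_assoc]
    simp only [Fin.sum_univ_succ, Fin.sum_Ioi_zero, Fin.sum_Ioi_succ, hz]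
    linear_combination h3 + 3 * z 0 * h2

/-- The prepotential with its cubic part written in power sums. -/
theorem trigPrepotential_eq {n : ℕ} (A B C : ℂ) (L : Fin n → Fin n → ℂ → ℂ) (z : Fin n → ℂ) :
    trigPrepotential A B C L z =
      (A - B + C / 3) * ∑ i, z i ^ 3 + (B - C / 2) * ((∑ i, z i) * ∑ i, z i ^ 2) +
        C / 6 * ((∑ i, z i) * ((∑ i, z i) * ∑ i, z i)) +
        ∑ i, ∑ j ∈ Finset.univ.erase i, 1 / 2 * L i j (exp (I * (z i - z j))) := by
  have h1 : ∑ i, z i ^ 2 * ∑ j ∈ Finset.univ.erase i, z j =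
      (∑ i, z i) * (∑ i, z i ^ 2) - ∑ i, z i ^ 3 := by
    rw [mul_comm, Finset.sum_mul, ← Finset.sum_sub_distrib]
    refine Finset.sum_congr rfl fun i _ => ?_
    rw [← Finset.add_sum_erase _ _ (Finset.mem_univ i)]
    ring
  have h2 := sum_Ioi_mul_mul z
  have h3 : 1 / 2 * ∑ i, ∑ j ∈ Finset.univ.erase i, L i j (exp (I * (z i - z j))) =
      ∑ i, ∑ j ∈ Finset.univ.erase i, 1 / 2 * L i j (exp (I * (z i - z j))) := by
    simp only [Finset.mul_sum]
  rw [trigPrepotential, h1]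
  linear_combination C / 6 * h2 + h3

theorem analyticAt_trigPrepotential {n : ℕ} (A B C : ℂ) {L : Fin n → Fin n → ℂ → ℂ}
    {z : Fin n → ℂ} (hL : ∀ i j, i ≠ j → AnalyticAt ℂ (L i j) (exp (I * (z i - z j)))) :
    AnalyticAt ℂ (trigPrepotential A B C L) z := by
  have hc : ∀ i, AnalyticAt ℂ (fun z : Fin n → ℂ => z i) z := fun i =>
    (ContinuousLinearMap.proj (R := ℂ) (φ := fun _ : Fin n => ℂ) i).analyticAt z
  have hLi : ∀ i, ∀ j ∈ Finset.univ.erase i,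
      AnalyticAt ℂ (fun z : Fin n → ℂ => 1 / 2 * L i j (exp (I * (z i - z j)))) z :=
    fun i j hj => by
      have hexp : AnalyticAt ℂ (fun z : Fin n → ℂ => exp (I * (z i - z j))) z :=
        (analyticAt_const.mul ((hc i).sub (hc j))).cexp
      exact analyticAt_const.mul (AnalyticAt.fun_comp
        (f := fun z : Fin n → ℂ => exp (I * (z i - z j)))
        (hL i j (Finset.ne_of_mem_erase hj).symm) hexp)
  rw [show trigPrepotential A B C L = _ from funext (trigPrepotential_eq A B C L)]
  have h1 : AnalyticAt ℂ (fun z : Fin n → ℂ => ∑ i, z i) z :=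
    Finset.analyticAt_fun_sum _ fun i _ => hc i
  have h2 : AnalyticAt ℂ (fun z : Fin n → ℂ => ∑ i, z i ^ 2) z :=
    Finset.analyticAt_fun_sum _ fun i _ => (hc i).fun_pow 2
  have h3 : AnalyticAt ℂ (fun z : Fin n → ℂ => ∑ i, z i ^ 3) z :=
    Finset.analyticAt_fun_sum _ fun i _ => (hc i).fun_pow 3
  exact (((analyticAt_const.mul h3).add (analyticAt_const.mul (h1.mul h2))).add
    (analyticAt_const.mul (h1.mul (h1.mul h1)))).add
    (Finset.analyticAt_fun_sum _ fun i _ => Finset.analyticAt_fun_sum _ fun j hj => hLi i j hj)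

/-- The third derivatives of the prepotential. Only the equation `θ³ Li₃ = x / (1 - x)` of the
branches enters. -/
theorem pderivAt_cube_trigPrepotential {n : ℕ} (A B C : ℂ) {L : Fin n → Fin n → ℂ → ℂ}
    {U : Fin n → Fin n → Set ℂ} (hL : ∀ i j, i ≠ j → IsTrilog (L i j) (U i j)) {z : Fin n → ℂ}
    (hz : Function.Injective fun i => exp (I * z i))
    (hzU : ∀ i j, i ≠ j → exp (I * (z i - z j)) ∈ U i j) (a b c : Fin n) :
    pderivAt a (pderivAt b (pderivAt c (trigPrepotential A B C L))) z =
      6 * (A - B + C / 3) * ((if c = a then 1 else 0) * if c = b then 1 else 0) +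
      2 * (B - C / 2) *
        ((if b = a then 1 else 0) + (if c = a then 1 else 0) + if c = b then 1 else 0) + C -
      I / 2 * ∑ i, ∑ j, ((if i = a then 1 else 0) - if j = a then 1 else 0) *
        ((if i = b then 1 else 0) - if j = b then 1 else 0) *
        ((if i = c then 1 else 0) - if j = c then 1 else 0) *
        (exp (I * z i) / (exp (I * z j) - exp (I * z i))) := by
  set α := A - B + C / 3
  set β := B - C / 2
  let e : Fin n → Fin n → Fin n → ℂ := fun c i j =>
    I * ((if i = c then 1 else 0) - if j = c then 1 else 0)
  let S : (Fin n → Fin n → ℂ → ℂ) → (Fin n → ℂ) → ℂ := fun K w =>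
    ∑ i, ∑ j ∈ Finset.univ.erase i, 1 / 2 * K i j (exp (I * (w i - w j)))
  have hS : ∀ (c : Fin n) (K : Fin n → Fin n → ℂ → ℂ) (w : Fin n → ℂ),
      (∀ i j, i ≠ j → AnalyticAt ℂ (K i j) (exp (I * (w i - w j)))) →
      HasPD c (S K) (S (fun i j x => e c i j * theta (K i j) x) w) w := fun c K w hK =>
    HasPD.sum fun i _ => HasPD.sum fun j hj =>
      (HasPD.comp_exp_sub (hK i j (Finset.ne_of_mem_erase hj).symm)).const_mul _
  let W : Set (Fin n → ℂ) := {w | ∀ i j, i ≠ j → exp (I * (w i - w j)) ∈ U i j}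
  have hW : W ∈ 𝓝 z := by
    have : ∀ᶠ w in 𝓝 z, ∀ i j, i ≠ j → exp (I * (w i - w j)) ∈ U i j := by
      rw [Filter.eventually_all]
      intro i
      rw [Filter.eventually_all]
      intro j
      by_cases hij : i = j
      · exact Eventually.of_forall fun w h => absurd hij h
      · have hcont : ContinuousAt (fun w : Fin n → ℂ => exp (I * (w i - w j))) z := by fun_prop
        filter_upwards [hcont.eventually_mem
          ((hL i j hij).analytic_and_theta.1.mem_nhds (hzU i j hij))] with w hw _
        exact hw
    exact this
  have hLana : ∀ w ∈ W, ∀ i j, i ≠ j → AnalyticAt ℂ (L i j) (exp (I * (w i - w j))) :=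
    fun w hw i j hij => (hL i j hij).analytic_and_theta.2.1 _ (hw i j hij)
  -- `F₁` and `F₂` are the first two iterated derivatives of the prepotential; in their polylogarithmic
  -- parts the branches `L` are replaced by `K₁` and `K₂`.
  let K₁ : Fin n → Fin n → ℂ → ℂ := fun i j x => e c i j * theta (L i j) x
  let K₂ : Fin n → Fin n → ℂ → ℂ := fun i j x => e b i j * theta (K₁ i j) x
  let K₃ : Fin n → Fin n → ℂ → ℂ := fun i j x => e a i j * theta (K₂ i j) x
  have hK₁ : ∀ w ∈ W, ∀ i j, i ≠ j → AnalyticAt ℂ (K₁ i j) (exp (I * (w i - w j))) :=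
    fun w hw i j hij => analyticAt_const.mul (hLana w hw i j hij).theta
  have hK₂ : ∀ w ∈ W, ∀ i j, i ≠ j → AnalyticAt ℂ (K₂ i j) (exp (I * (w i - w j))) :=
    fun w hw i j hij => analyticAt_const.mul (hK₁ w hw i j hij).theta
  let F₁ : (Fin n → ℂ) → ℂ := fun w =>
    3 * α * w c ^ 2 + β * ((∑ i, w i ^ 2) + 2 * ((∑ i, w i) * w c)) +
      C / 2 * ((∑ i, w i) * ∑ i, w i) + S K₁ w
  let F₂ : (Fin n → ℂ) → ℂ := fun w =>
    6 * α * (if c = b then 1 else 0) * w c +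
      2 * β * (w b + (w c + (if c = b then 1 else 0) * ∑ i, w i)) + C * ∑ i, w i + S K₂ w
  have hF₁ : ∀ w ∈ W, pderivAt c (trigPrepotential A B C L) w = F₁ w := fun w hw => by
    rw [show trigPrepotential A B C L = _ from funext (trigPrepotential_eq A B C L)]
    refine ((((HasPD.coord_cube_sum.const_mul α).add
      ((HasPD.coord_sum.mul HasPD.coord_sq_sum).const_mul β)).add
      ((HasPD.coord_sum.mul (HasPD.coord_sum.mul HasPD.coord_sum)).const_mul (C / 6))).add
      (hS c L w (hLana w hw))).2.trans ?_
    simp only [F₁, K₁]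
    ring
  have hF₂ : ∀ w ∈ W, pderivAt b F₁ w = F₂ w := fun w hw => by
    refine (((((HasPD.coord_sq c).const_mul (3 * α)).add
      ((HasPD.coord_sq_sum.add ((HasPD.coord_sum.mul (HasPD.coord c)).const_mul 2)).const_mul
        β)).add ((HasPD.coord_sum.mul HasPD.coord_sum).const_mul (C / 2))).add
      (hS b K₁ w (hK₁ w hw))).2.trans ?_
    simp only [F₂, K₂]
    ring
  have hF₃ := ((((HasPD.coord (c := a) (w := z) c).const_mul
    (6 * α * (if c = b then 1 else 0))).add
    (((HasPD.coord b).add ((HasPD.coord c).add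
      (HasPD.coord_sum.const_mul (if c = b then 1 else 0)))).const_mul (2 * β))).add
    (HasPD.coord_sum.const_mul C)).add (hS a K₂ z (hK₂ z (mem_of_mem_nhds hW)))
  have e₁ : pderivAt c (trigPrepotential A B C L) =ᶠ[𝓝 z] F₁ := eventually_of_mem hW hF₁
  have e₂ : pderivAt b (pderivAt c (trigPrepotential A B C L)) =ᶠ[𝓝 z] F₂ := by
    filter_upwards [e₁.eventuallyEq_nhds, hW] with w hw hwW
    rw [HasPD.pderivAt_congr hw, hF₂ w hwW]
  rw [HasPD.pderivAt_congr e₂]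
  refine hF₃.2.trans ?_
  have hSK₃ : S K₃ z = -(I / 2 * ∑ i, ∑ j, ((if i = a then 1 else 0) - if j = a then 1 else 0) *
        ((if i = b then 1 else 0) - if j = b then 1 else 0) *
        ((if i = c then 1 else 0) - if j = c then 1 else 0) *
        (exp (I * z i) / (exp (I * z j) - exp (I * z i)))) := by
    rw [← neg_mul, Finset.mul_sum]
    refine Finset.sum_congr rfl fun i _ => ?_
    rw [Finset.mul_sum, ← Finset.sum_erase Finset.univ (a := i) (by simp)]
    refine Finset.sum_congr rfl fun j hj => ?_
    have hij : i ≠ j := (Finset.ne_of_mem_erase hj).symm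
    have hode := (hL i j hij).analytic_and_theta.2.2 _ (hzU i j hij)
    have hx : exp (I * (z i - z j)) = exp (I * z i) / exp (I * z j) := by
      rw [mul_sub, exp_sub]
    have hxj : exp (I * z j) ≠ 0 := exp_ne_zero _
    have hd : exp (I * z j) - exp (I * z i) ≠ 0 := sub_ne_zero.2 fun h => hij (hz h).symm
    have hθ : theta (theta (theta (L i j))) (exp (I * (z i - z j))) =
        exp (I * z i) / (exp (I * z j) - exp (I * z i)) := by
      rw [hx] at hode ⊢
      field_simp at hode ⊢
      linear_combination hode
    simp only [K₃, K₂, K₁, theta_const_mul]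
    rw [hθ]
    simp only [e]
    linear_combination (exp (I * z i) / (exp (I * z j) - exp (I * z i))) * I / 2 *
      ((if i = a then 1 else 0) - if j = a then 1 else 0) *
        ((if i = b then 1 else 0) - if j = b then 1 else 0) *
        ((if i = c then 1 else 0) - if j = c then 1 else 0) * I_sq
  rw [show S (fun i j x => e a i j * theta (K₂ i j) x) z = S K₃ z from rfl, hSK₃]
  ring

/-! ### Comparison of the two tensors -/

/-- The tensor of third derivatives of the prepotential for cubic coefficients with
`A - B + C/3 = α`, `B - C/2 = β`, in terms of the exponentials `x_i = e^{iz_i}`. -/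
noncomputable def cubicTensor {n : ℕ} (α β C : ℂ) (x : Fin n → ℂ) (a b c : Fin n) : ℂ :=
  6 * α * ((if c = a then 1 else 0) * if c = b then 1 else 0) +
    2 * β * ((if b = a then 1 else 0) + (if c = a then 1 else 0) + if c = b then 1 else 0) + C -
    I / 2 * ∑ i, ∑ j, ((if i = a then 1 else 0) - if j = a then 1 else 0) *
      ((if i = b then 1 else 0) - if j = b then 1 else 0) *
      ((if i = c then 1 else 0) - if j = c then 1 else 0) * (x i / (x j - x i))

theorem sum_cubicTensor {n : ℕ} (α β C : ℂ) (x : Fin n → ℂ) (a c : Fin n) :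
    ∑ b, cubicTensor α β C x a b c =
      (6 * α + 2 * n * β) * (if c = a then 1 else 0) + 4 * β + n * C := by
  have h0 : ∑ b : Fin n, ∑ i, ∑ j, ((if i = a then 1 else 0) - if j = a then 1 else 0) *
      ((if i = b then 1 else 0) - if j = b then 1 else 0) *
      ((if i = c then 1 else 0) - if j = c then 1 else 0) * (x i / (x j - x i)) = (0 : ℂ) := by
    rw [Finset.sum_comm]
    refine Finset.sum_eq_zero fun i _ => ?_
    rw [Finset.sum_comm]
    refine Finset.sum_eq_zero fun j _ => ?_
    rw [← Finset.sum_mul, ← Finset.sum_mul, ← Finset.mul_sum]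
    simp
  simp only [cubicTensor]
  rw [Finset.sum_sub_distrib, ← Finset.mul_sum, h0]
  simp only [Finset.sum_add_distrib, ← Finset.mul_sum]
  simp
  split_ifs <;> ring

theorem cubicTensor_of_ne {n : ℕ} (α β C : ℂ) {x : Fin n → ℂ} (hx : Function.Injective x)
    {a b : Fin n} (hab : a ≠ b) (c : Fin n) :
    (x b - x a) * cubicTensor α β C x a b c =
      (x b - x a) * (2 * β * ((if a = c then 1 else 0) + if b = c then 1 else 0) + C) +
        I / 2 * (x a + x b) * ((if a = c then 1 else 0) - if b = c then 1 else 0) := by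
  have hd : x b - x a ≠ 0 := sub_ne_zero.2 fun h => hab (hx h).symm
  have hd' : x a - x b ≠ 0 := sub_ne_zero.2 fun h => hab (hx h)
  have hprod : ∀ i j : Fin n, ((if i = a then 1 else 0) - if j = a then 1 else 0) *
      ((if i = b then 1 else 0) - if j = b then 1 else 0) =
      -((if i = a then 1 else 0) * if j = b then (1 : ℂ) else 0) -
        (if i = b then 1 else 0) * if j = a then 1 else 0 := fun i j => by
    have h : ∀ i : Fin n, (if i = a then (1 : ℂ) else 0) * (if i = b then 1 else 0) = 0 := by
      intro i
      split_ifs with h1 h2 <;> simp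
      exact hab (h1.symm.trans h2)
    linear_combination h i + h j
  have hS : ∑ i, ∑ j, ((if i = a then 1 else 0) - if j = a then 1 else 0) *
      ((if i = b then 1 else 0) - if j = b then 1 else 0) *
      ((if i = c then 1 else 0) - if j = c then 1 else 0) * (x i / (x j - x i)) =
      -((if a = c then 1 else 0) - if b = c then 1 else 0) * (x a / (x b - x a)) -
        ((if b = c then 1 else 0) - if a = c then 1 else 0) * (x b / (x a - x b)) := by
    have hpick : ∀ (a b : Fin n) (g : Fin n → Fin n → ℂ),
        ∑ i, ∑ j, (if i = a then 1 else 0) * (if j = b then 1 else 0) * g i j = g a b :=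
      fun a b g => by simp
    let g : Fin n → Fin n → ℂ := fun i j =>
      ((if i = c then 1 else 0) - if j = c then 1 else 0) * (x i / (x j - x i))
    calc _ = ∑ i, ∑ j, (-((if i = a then 1 else 0) * (if j = b then 1 else 0) * g i j) -
          (if i = b then 1 else 0) * (if j = a then 1 else 0) * g i j) := by
          refine Finset.sum_congr rfl fun i _ => Finset.sum_congr rfl fun j _ => ?_
          rw [hprod]
          ring
      _ = _ := by
          simp only [Finset.sum_sub_distrib, Finset.sum_neg_distrib, hpick]
          ring
  rw [cubicTensor, hS, if_neg hab.symm,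
    show (if c = a then (1 : ℂ) else 0) * (if c = b then 1 else 0) = 0 by
      split_ifs with h1 h2 <;> simp
      exact hab (h1.symm.trans h2)]
  simp only [eq_comm (a := c)]
  rw [← neg_sub (x b) (x a)]
  field_simp
  ring

/-- A tensor that satisfies the relations of the dual multiplication is the tensor of third
derivatives of the prepotential: off the diagonal `a = b` the relations determine it, and the diagonal
follows from the sum over `b`. -/
theorem eq_cubicTensor {k m : ℕ} (hm : 1 ≤ m) {x : Fin (k + m) → ℂ} (hx : Function.Injective x)
    (T : Fin (k + m) → Fin (k + m) → Fin (k + m) → ℂ)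
    (h1 : ∀ a b c, (x b - x a) * T a b c =
      I * (x b * ((if a = c then 1 else 0) - 1 / m) - x a * ((if b = c then 1 else 0) - 1 / m)))
    (h2 : ∀ a c, ∑ b, T a b c = I * k * ((if a = c then 1 else 0) - 1 / m)) {α β C : ℂ}
    (hα : 6 * α + 2 * ((k + m : ℕ) : ℂ) * β = I * k) (hβ : 2 * β = I / 2) (hC : C = -(I / m))
    (a b c : Fin (k + m)) : cubicTensor α β C x a b c = T a b c := by
  have hm0 : (m : ℂ) ≠ 0 := by exact_mod_cast (by omega : m ≠ 0)
  have hne : ∀ a b c, a ≠ b → cubicTensor α β C x a b c = T a b c := fun a b c hab => by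
    have hd : x b - x a ≠ 0 := sub_ne_zero.2 fun h => hab (hx h).symm
    apply mul_left_cancel₀ hd
    rw [cubicTensor_of_ne α β C hx hab, h1, hβ, hC]
    ring
  by_cases hab : a = b
  · subst hab
    have h3 := (sum_cubicTensor α β C x a c).trans
      (show _ = ∑ b, T a b c by
        rw [h2, hα, hC]
        simp only [eq_comm (a := c)]
        push_cast
        field_simp
        linear_combination 2 * (m : ℂ) * hβ)
    rw [← Finset.add_sum_erase _ _ (Finset.mem_univ a), ← Finset.add_sum_erase _ (fun b => T a b c)
      (Finset.mem_univ a), Finset.sum_congr rfl fun b hb =>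
        hne a b c (Finset.ne_of_mem_erase hb).symm] at h3
    exact add_right_cancel h3
  · exact hne a b c hab

/-- The Gram matrix `1 - (1/m) J` of the intersection form, with `J` the all-ones matrix, has
determinant `1 - (k+m)/m = -k/m`. -/
theorem isUnit_det_interGram {k m : ℕ} (hk : 1 ≤ k) (hm : 1 ≤ m) :
    IsUnit (Matrix.of fun i j : Fin (k + m) => (if i = j then (1 : ℂ) else 0) - 1 / m).det := by
  have hm0 : (m : ℂ) ≠ 0 := by exact_mod_cast (by omega : m ≠ 0)
  have hk0 : (k : ℂ) ≠ 0 := by exact_mod_cast (by omega : k ≠ 0)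
  rw [isUnit_iff_ne_zero]
  intro h
  obtain ⟨v, hv0, hv⟩ := Matrix.exists_mulVec_eq_zero_iff.2 h
  have h1 : ∀ i, v i = 1 / m * ∑ j, v j := fun i => by
    have := congrFun hv i
    simp only [Matrix.mulVec, dotProduct, Matrix.of_apply, sub_mul, Finset.sum_sub_distrib,
      ← Finset.mul_sum, Pi.zero_apply] at this
    simpa [sub_eq_zero] using this
  have h2 : ∑ j, v j = ((k + m : ℕ) : ℂ) * (1 / m * ∑ j, v j) := by
    conv_lhs => rw [Finset.sum_congr rfl fun i _ => h1 i]
    simp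
  have h3 : ∑ j, v j = 0 := by
    push_cast at h2
    field_simp at h2
    have : (k : ℂ) * ∑ j, v j = 0 := by linear_combination -h2
    exact (mul_eq_zero.1 this).resolve_left hk0
  apply hv0
  ext i
  rw [h1, h3, mul_zero, Pi.zero_apply]

theorem mainTheorem2 (k m : ℕ) (hk : 1 ≤ k) (hm : 1 ≤ m) :
    -- the structures are well defined: the metric is nondegenerate, `e` is the unity,
    -- and `E⁻¹ ∘ E = e` off the discriminant
    (∀ a ∈ trigSpace k m, IsUnit (trigGram k m a).det ∧
      ∀ u : Fin (k + m) → ℂ, trigMul k m a (trigUnit k m) u = u) ∧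
    (∀ z ∈ trigRegular k m,
      trigMul k m (trigCoeff k m z) (trigEulerInv k m (trigCoeff k m z))
        (trigEuler k m (trigCoeff k m z)) = trigUnit k m) ∧
    -- the `z i` are the zeros of `λ`, every `λ` arises, and off the discriminant
    -- they are local coordinates
    (∀ z : Fin (k + m) → ℂ, trigCoeff k m z ∈ trigSpace k m ∧
      ∀ p : ℂ, trigPoly k m (trigCoeff k m z) p =
        Complex.exp (-(Complex.I * (m : ℂ) * p)) *
          ∏ α : Fin (k + m), (Complex.exp (Complex.I * p) - Complex.exp (Complex.I * z α))) ∧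
    (∀ a ∈ trigSpace k m, ∃ z : Fin (k + m) → ℂ, trigCoeff k m z = a) ∧
    (AnalyticOnNhd ℂ (trigCoeff k m) Set.univ ∧
      ∀ z ∈ trigRegular k m, LinearIndependent ℂ (trigField k m z)) ∧
    -- they are flat coordinates of the intersection form
    (∃ G : Matrix (Fin (k + m)) (Fin (k + m)) ℂ, G.IsSymm ∧ IsUnit G.det ∧
      ∀ z ∈ trigRegular k m, ∀ i j : Fin (k + m),
        trigInter k m (trigCoeff k m z) (trigField k m z i) (trigField k m z j) = G i j) ∧
    -- branches of the trilogarithm exist near every point other than `0` and `1`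
    (∀ x : ℂ, x ≠ 0 → x ≠ 1 → ∃ (f : ℂ → ℂ) (U : Set ℂ), IsTrilog f U ∧ x ∈ U) ∧
    -- for every choice of branches the explicit function is a dual prepotential
    (∀ (L : Fin (k + m) → Fin (k + m) → ℂ → ℂ) (U : Fin (k + m) → Fin (k + m) → Set ℂ),
      (∀ i j, i ≠ j → IsTrilog (L i j) (U i j)) →
      ∀ F : (Fin (k + m) → ℂ) → ℂ,
      F = trigPrepotential
        (-(Complex.I / (12 * (m : ℂ))) *
          (((m : ℂ) - 2) * ((m : ℂ) - 1) - (m : ℂ) * (k : ℂ)))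
        (-(Complex.I / (4 * (m : ℂ))) * (2 - (m : ℂ)))
        (-(Complex.I / (m : ℂ))) L →
      ∀ z ∈ trigRegular k m,
        (∀ i j, i ≠ j → Complex.exp (Complex.I * (z i - z j)) ∈ U i j) →
        AnalyticAt ℂ F z ∧
        ∀ a b c : Fin (k + m),
          pderivAt a (pderivAt b (pderivAt c F)) z =
            trigInter k m (trigCoeff k m z)
              (trigStar k m (trigCoeff k m z) (trigField k m z a) (trigField k m z b))
              (trigField k m z c)) := by
  refine ⟨fun a ha => ⟨(critModel hk hm ha).isUnit_det_trigGram, fun u => ?_⟩,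
    fun z hz => trigMul_trigEulerInv hk hm hz,
    fun z => ⟨trigCoeff_mem_trigSpace z, trigPoly_trigCoeff k m z⟩,
    fun a ha => exists_trigCoeff_eq hk ha,
    ⟨analyticOnNhd_trigCoeff k m, fun z hz => linearIndependent_trigField hz⟩,
    ⟨Matrix.of fun i j => (if i = j then (1 : ℂ) else 0) - 1 / m, ?_, isUnit_det_interGram hk hm,
      fun z hz i j => trigInter_trigField hk hm hz i j⟩,
    fun x h0 h1 => exists_isTrilog h0 h1, ?_⟩
  · rw [(critModel hk hm ha).trigMul_eq, critModel_ι_unit, one_mul, LinearEquiv.symm_apply_apply]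
  · ext i j
    simp [eq_comm]
  · rintro L U hL F rfl z hz hzU
    refine ⟨analyticAt_trigPrepotential _ _ _ fun i j hij =>
      (hL i j hij).analytic_and_theta.2.1 _ (hzU i j hij), fun a b c => ?_⟩
    have hm0 : (m : ℂ) ≠ 0 := by exact_mod_cast (by omega : m ≠ 0)
    rw [pderivAt_cube_trigPrepotential _ _ _ hL hz hzU a b c]
    refine eq_cubicTensor hm hz (fun a b c => trigInter k m (trigCoeff k m z)
      (trigStar k m (trigCoeff k m z) (trigField k m z a) (trigField k m z b))
      (trigField k m z c)) (fun a b c => ?_) (fun a c => ?_) ?_ ?_ rfl a b c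
    · obtain ⟨M, hM⟩ := trigInter_linear_left hk hm z (trigField k m z c)
      have h := congrArg M (trigStar_trigField hk hm hz a b)
      simp only [map_smul, map_sub, smul_eq_mul] at h
      simp only [← hM, trigInter_trigField hk hm hz] at h
      exact h
    · obtain ⟨M, hM⟩ := trigInter_linear_left hk hm z (trigField k m z c)
      have h := congrArg M (sum_trigStar_trigField hk hm hz a)
      simp only [map_smul, map_sum, smul_eq_mul] at h
      simp only [← hM, trigInter_trigField hk hm hz] at h
      exact h
    · push_cast
      field_simp
      ring
    · field_simp
      ring
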